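/- Let $f:[0,\infty)\to\mathbb{R}$ be $C^2$, let $q_0>0$ with $f'(q_0)>0$, and put $c=\sqrt{q_0f'(q_0)}$. Consider the nonlinear Schrödinger equation $$ i u_t=-\tfrac12 u_{xx}+f(|u|^2)u,\qquad x\in\mathbb{R}. $$ A dark soliton of speed $v$ (with background density $q_0$ and frequency $\omega=f(q_0)$) is a $C^2$ function $U:\mathbb{R}\to\mathbb{C}$ such that $u(x,t)=U(x-vt)e^{-i\omega t}$ is a classical solution and $U=\Phi e^{i\Theta}$ with $C^2$ functions $\Phi:\mathbb{R}\to[0,\sqrt{q_0})$ and $\Theta:\mathbb{R}\to[-\pi,\pi]$ such that, exponentially fast, $\Phi(z)\to\sqrt{q_0}$ as $z\to\pm\infty$, $\Theta(z)\to 0$ as $z\to+\infty$ and $\Theta(z)\to\Theta_-$ as $z\to-\infty$ for some $\Theta_-\in\mathbb{R}$, and such that $\Phi'(0)=0$. Assume that $(U_v)_{0<|v|<c}$ is a family such that $U_v$ is a dark soliton of speed $v$ for every $v\in(-c,0)\cup(0,c)$. Define the renormalized momentum $$ P_r(v)=\frac{i}{2}\int_{\mathbb{R}}\left(\overline{U_v}\,U_v'-U_v\,\overline{U_v}'\right)\left(1-\frac{q_0}{|U_v|^2}\right)dx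 . $$ Then: (i) the integral converges absolutely for every $v\in(-c,0)\cup(0,c)$, and $P_r$ is a $C^1$ function on $(-c,0)\cup(0,c)$; (ii) if the family has a black soliton as its limit, that is, if $\phi_0(x)=\lim_{v\downarrow0}U_v(x)$ exists for every $x\in\mathbb{R}$ and is a real-valued $C^2$ function which is either a bubble ($\phi_0$ is even, $0\le\phi_0(0)<\sqrt{q_0}$, and $\phi_0(x)\to\sqrt{q_0}$ exponentially fast as $x\to\pm\infty$) or a kink ($\phi_0$ is odd, $\phi_0(0)=0$, and $\phi_0(x)\to\pm\sqrt{q_0}$ exponentially fast as $x\to\pm\infty$), then the limit $\lim_{v\downarrow0}P_r'(v)$ exists and is finite. -/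

import Mathlib

open Filter Topology MeasureTheory
open scoped ComplexConjugate

/-- `u = u(x, t)` is a classical solution on the whole line and for all times of the
nonlinear Schrödinger equation `i u_t = -(1/2) u_xx + f(|u|^2) u`. -/
def IsNLSSolution (f : ℝ → ℝ) (u : ℝ → ℝ → ℂ) : Prop :=
  ContDiff ℝ 2 (fun p : ℝ × ℝ => u p.1 p.2) ∧
  ∀ x t : ℝ,
    Complex.I * deriv (fun s => u x s) t
      = -(1 / 2 : ℂ) * iteratedDeriv 2 (fun y => u y t) x
        + ((f (‖u x t‖ ^ 2) : ℝ) : ℂ) * u x t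

/-- `g` converges exponentially fast to `a` at `+∞`. -/
def ExpTendstoTop (g : ℝ → ℝ) (a : ℝ) : Prop :=
  ∃ C κ : ℝ, 0 < κ ∧ ∀ z : ℝ, 0 ≤ z → |g z - a| ≤ C * Real.exp (-κ * z)

/-- `g` converges exponentially fast to `a` at `-∞`. -/
def ExpTendstoBot (g : ℝ → ℝ) (a : ℝ) : Prop :=
  ∃ C κ : ℝ, 0 < κ ∧ ∀ z : ℝ, z ≤ 0 → |g z - a| ≤ C * Real.exp (κ * z)

/-- `U` is the profile of a dark soliton `u(x, t) = U(x - v t) e^{-i ω t}` of speed `v` over the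
background density `q₀`, where `U = Φ e^{i Θ}`, with the normalization `Φ'(0) = 0`, `Θ₊ = 0`. -/
def IsDarkSoliton (f : ℝ → ℝ) (q₀ ω v : ℝ) (U : ℝ → ℂ) : Prop :=
  IsNLSSolution f (fun x t => U (x - v * t) * Complex.exp (-Complex.I * (ω : ℂ) * (t : ℂ))) ∧
  ∃ (Φ Θ : ℝ → ℝ) (Θm : ℝ),
    ContDiff ℝ 2 U ∧ ContDiff ℝ 2 Φ ∧ ContDiff ℝ 2 Θ ∧
    (∀ z, U z = (Φ z : ℂ) * Complex.exp (Complex.I * (Θ z : ℂ))) ∧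
    (∀ z, 0 ≤ Φ z ∧ Φ z < Real.sqrt q₀) ∧
    (∀ z, Θ z ∈ Set.Icc (-Real.pi) Real.pi) ∧
    ExpTendstoTop Φ (Real.sqrt q₀) ∧ ExpTendstoBot Φ (Real.sqrt q₀) ∧
    ExpTendstoTop Θ 0 ∧ ExpTendstoBot Θ Θm ∧
    deriv Φ 0 = 0

/-- A bubble: an even black-soliton profile. -/
def IsBubbleProfile (q₀ : ℝ) (φ : ℝ → ℝ) : Prop :=
  (∀ x, φ (-x) = φ x) ∧ 0 ≤ φ 0 ∧ φ 0 < Real.sqrt q₀ ∧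
  ExpTendstoTop φ (Real.sqrt q₀) ∧ ExpTendstoBot φ (Real.sqrt q₀)

/-- A kink: an odd black-soliton profile. -/
def IsKinkProfile (q₀ : ℝ) (φ : ℝ → ℝ) : Prop :=
  (∀ x, φ (-x) = -φ x) ∧ φ 0 = 0 ∧
  ExpTendstoTop φ (Real.sqrt q₀) ∧ ExpTendstoBot φ (-Real.sqrt q₀)

/-- `φ` is the black soliton of the family `v ↦ U v`: the limit of `U v` as `v ↓ 0`
exists and is a real-valued smooth function, which is a bubble or a kink. -/
def IsBlackSoliton (q₀ : ℝ) (U : ℝ → ℝ → ℂ) (φ : ℝ → ℝ) : Prop :=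
  (∀ x, Tendsto (fun v => U v x) (𝓝[>] 0) (𝓝 (φ x : ℂ))) ∧
  ContDiff ℝ 2 φ ∧
  (IsBubbleProfile q₀ φ ∨ IsKinkProfile q₀ φ)

/-- The integrand `(i/2) (ū u_x - u ū_x) (1 - q₀/|u|^2)` of the renormalized momentum. -/
noncomputable def momentumDensity (q₀ : ℝ) (u : ℝ → ℂ) (x : ℝ) : ℂ :=
  Complex.I / 2 * (conj (u x) * deriv u x - u x * deriv (fun y => conj (u y)) x)
    * (1 - (q₀ : ℂ) / ((‖u x‖ ^ 2 : ℝ) : ℂ))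

/-- The renormalized momentum `P_r[u]`. The integral is real, see
`ofReal_renormalizedMomentum`. -/
noncomputable def renormalizedMomentum (q₀ : ℝ) (u : ℝ → ℂ) : ℝ :=
  (∫ x : ℝ, momentumDensity q₀ u x).re

theorem momentumDensity_conj (q₀ : ℝ) (u : ℝ → ℂ) (x : ℝ) :
    conj (momentumDensity q₀ u x) = momentumDensity q₀ u x := by
  have h : deriv (fun y => conj (u y)) x = conj (deriv u x) := deriv.star
  simp only [momentumDensity, h, map_mul, map_sub, map_div₀, map_one, map_ofNat,
    Complex.conj_I, Complex.conj_conj, Complex.conj_ofReal]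
  ring

theorem ofReal_renormalizedMomentum (q₀ : ℝ) (u : ℝ → ℂ) :
    ((renormalizedMomentum q₀ u : ℝ) : ℂ) = ∫ x : ℝ, momentumDensity q₀ u x := by
  rw [renormalizedMomentum, ← Complex.conj_eq_iff_re, ← integral_conj]
  simp only [momentumDensity_conj]

open Set

/-! Write ρ = |U|², m = v² and F for the primitive of f − f(q₀) vanishing at q₀. The profile
equation conserves angular momentum and energy, up to terms in ρ. Evaluated at +∞ these laws become
Im(Ū U') = v(ρ − q₀) and |U'|² = 2F(ρ). Hence the momentum density is −v(q₀ − ρ)²/ρ, and ρ'² = 4(q₀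
− ρ)²(H(ρ) − m) with H(x) = 2xF(x)/(q₀ − x)² (`speedSq`). So ρ solves a Newton equation that depends
on v only through m.

By uniqueness for that equation ρ is even and strictly increasing on (0, ∞). Its minimum R(m) = ρ(0)
is the last point below q₀ where H = m, and H'(R(m)) > 0. Taking x = ρ as variable gives P_r = −v
∫_{R(m)}^{q₀} (q₀ − x)/(x√(H(x) − m)) dx.

For part (i) the integral is cut at R(h₁) with m < h₁ fixed. The tail is differentiated under the
integral sign. Near the turning point the variable h = H(x) gives an Abel integral of κ(h)/√(h − m)
with κ = (q₀ − R)/(R H'(R)), and h = m + (h₁ − m)s² turns it into a regular integral over a fixed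
interval.

For part (ii) let a be the limit of R at 0⁺. A Gronwall argument shows H'(a) ≠ 0: a degenerate
turning point would keep the limit profile at density a. If a > 0, κ is C¹ in R up to the limit. If
a = 0 (vacuum), κ(h) = q₀/h + φ(R(h)) with φ of class C¹. The singular term contributes the explicit
2q₀ arctan(√(h₁ − v²)/v) to −P_r, whose derivative stays finite. What remains is v J(v²) with J'
bounded. -/

/-! ### Extending the nonlinearity to the whole line -/

theorem exists_contDiff_primitive_extension {n : ℕ} {f f' g' : ℝ → ℝ}
    (hf : ∀ x ∈ Ici (0 : ℝ), HasDerivWithinAt f (f' x) (Ici 0) x)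
    (hg' : ContDiff ℝ n g') (hfg : EqOn g' f' (Ici 0)) :
    ∃ g : ℝ → ℝ, ContDiff ℝ (n + 1) g ∧ EqOn g f (Ici 0) := by
  have hd : ∀ x, HasDerivAt (fun y => f 0 + ∫ t in (0 : ℝ)..y, g' t) (g' x) x := fun x =>
    (intervalIntegral.integral_hasDerivAt_right (hg'.continuous.intervalIntegrable _ _)
      (hg'.continuous.stronglyMeasurableAtFilter _ _) hg'.continuous.continuousAt).const_add _
  refine ⟨fun y => f 0 + ∫ t in (0 : ℝ)..y, g' t, ?_, fun x hx => ?_⟩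
  · rw [contDiff_succ_iff_deriv]
    refine ⟨fun x => (hd x).differentiableAt, by simp, ?_⟩
    rwa [show deriv _ = g' from funext fun x => (hd x).deriv]
  · have hx0 : (0 : ℝ) ≤ x := hx
    have key := constant_of_has_deriv_right_zero (a := 0) (b := x)
      (f := fun y => (f 0 + ∫ t in (0 : ℝ)..y, g' t) - f y) ?_ ?_ x ⟨hx0, le_rfl⟩
    · simpa [sub_eq_zero] using key
    · exact fun y hy => ((hd y).continuousAt.continuousWithinAt).sub
        ((hf y hy.1).continuousWithinAt.mono Icc_subset_Ici_self)
    · intro y hy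
      have h1 := (hd y).hasDerivWithinAt (s := Ici y) |>.sub ((hf y hy.1).mono (Ici_subset_Ici.2 hy.1))
      rwa [hfg hy.1, sub_self] at h1

/-- The second derivative is continued by its value at 0 and then integrated twice. The Newton
equation can thus be handled with a nonlinearity on all of ℝ, while solitons only see it on [0, ∞).
-/
theorem exists_contDiff_two_extension {f : ℝ → ℝ} (hf : ContDiffOn ℝ 2 f (Ici 0)) :
    ∃ g : ℝ → ℝ, ContDiff ℝ 2 g ∧ EqOn g f (Ici 0) := by
  have hu := uniqueDiffOn_Ici (0 : ℝ)
  rw [show (2 : WithTop ℕ∞) = 1 + 1 by norm_num, contDiffOn_succ_iff_derivWithin hu] at hf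
  obtain ⟨h1, -, h2⟩ := hf
  rw [show (1 : WithTop ℕ∞) = 0 + 1 by norm_num, contDiffOn_succ_iff_derivWithin hu] at h2
  obtain ⟨h2, -, h3⟩ := h2
  have hcont : Continuous fun t => derivWithin (derivWithin f (Ici 0)) (Ici 0) (max t 0) :=
    h3.continuousOn.comp_continuous (by fun_prop) fun t => mem_Ici.2 (le_max_right _ _)
  obtain ⟨g1, hg1, he1⟩ := exists_contDiff_primitive_extension (n := 0)
    (fun x hx => (h2 x hx).hasDerivWithinAt) (contDiff_zero.2 hcont)
    fun x hx => by simp [max_eq_left (mem_Ici.1 hx)]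
  obtain ⟨g, hg, he⟩ := exists_contDiff_primitive_extension (n := 1)
    (fun x hx => (h1 x hx).hasDerivWithinAt) (by simpa using hg1) he1
  exact ⟨g, by simpa [one_add_one_eq_two] using hg, he⟩

/-! ### Calculus tools: parameter integrals and derivatives at infinity -/

/-- Dominated differentiation where constants suffice as dominating functions, because the measure
is finite. -/
theorem hasDerivAt_integral_of_locally_bounded {μ : Measure ℝ} [IsFiniteMeasure μ]
    {F F' : ℝ → ℝ → ℝ} {I : Set ℝ} (hI : IsOpen I)
    (hmeas' : ∀ m ∈ I, AEStronglyMeasurable (F' m) μ)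
    (hint : ∀ m ∈ I, Integrable (F m) μ)
    (hd : ∀ᵐ x ∂μ, ∀ m ∈ I, HasDerivAt (fun m => F m x) (F' m x) m)
    (hc : ∀ᵐ x ∂μ, ContinuousOn (fun m => F' m x) I)
    (hb : ∀ m ∈ I, ∃ s ∈ 𝓝 m, ∃ C, ∀ᵐ x ∂μ, ∀ m' ∈ s, |F' m' x| ≤ C) :
    (∀ m ∈ I, HasDerivAt (fun m => ∫ x, F m x ∂μ) (∫ x, F' m x ∂μ) m) ∧
      ContinuousOn (fun m => ∫ x, F' m x ∂μ) I := by
  refine ⟨fun m hm => ?_, fun m hm => ?_⟩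
  · obtain ⟨s, hs, C, hC⟩ := hb m hm
    refine (hasDerivAt_integral_of_dominated_loc_of_deriv_le (bound := fun _ => C)
      (inter_mem hs (hI.mem_nhds hm))
      ?_ (hint m hm) (hmeas' m hm) ?_ (integrable_const _) ?_).2
    · filter_upwards [hI.mem_nhds hm] with m' hm' using (hint m' hm').aestronglyMeasurable
    · filter_upwards [hC] with x hx m' hm' using hx m' hm'.1
    · filter_upwards [hd] with x hx m' hm' using hx m' hm'.2
  · obtain ⟨s, hs, C, hC⟩ := hb m hm
    refine (continuousAt_of_dominated (bound := fun _ => C) ?_ ?_ (integrable_const _)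
      ?_).continuousWithinAt
    · filter_upwards [hI.mem_nhds hm] with m' hm' using hmeas' m' hm'
    · filter_upwards [hs] with m' hm'
      filter_upwards [hC] with x hx using hx m' hm'
    · filter_upwards [hc] with x hx using hx.continuousAt (hI.mem_nhds hm)

/-- A function with a limit at infinity has a derivative that is small along a sequence. -/
theorem exists_seq_tendsto_deriv_zero {g g' : ℝ → ℝ} {a : ℝ} (hg : ∀ z, HasDerivAt g (g' z) z)
    (ha : Tendsto g atTop (𝓝 a)) :
    ∃ ξ : ℕ → ℝ, Tendsto ξ atTop atTop ∧ Tendsto (fun n => g' (ξ n)) atTop (𝓝 0) := by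
  have h : ∀ n : ℕ, ∃ x ∈ Ioo (n : ℝ) (n + 1), g' x = (g (n + 1) - g n) / ((n : ℝ) + 1 - n) :=
    fun n => exists_hasDerivAt_eq_slope g g' (by linarith)
      (fun x _ => (hg x).continuousAt.continuousWithinAt) fun x _ => hg x
  choose ξ hξ hξ' using h
  refine ⟨ξ, tendsto_atTop_mono (fun n => (hξ n).1.le) tendsto_natCast_atTop_atTop, ?_⟩
  have h1 : Tendsto (fun n : ℕ => g (n : ℝ)) atTop (𝓝 a) := ha.comp tendsto_natCast_atTop_atTop
  have h2 : Tendsto (fun n : ℕ => g ((n : ℝ) + 1)) atTop (𝓝 a) :=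
    ha.comp (tendsto_atTop_add_const_right _ _ tendsto_natCast_atTop_atTop)
  simpa [hξ'] using h2.sub h1

theorem eq_zero_of_tendsto_deriv {g g' : ℝ → ℝ} {a b : ℝ} (hg : ∀ z, HasDerivAt g (g' z) z)
    (ha : Tendsto g atTop (𝓝 a)) (hb : Tendsto g' atTop (𝓝 b)) : b = 0 := by
  obtain ⟨ξ, h1, h2⟩ := exists_seq_tendsto_deriv_zero hg ha
  exact tendsto_nhds_unique (hb.comp h1) h2

theorem eq_zero_of_tendsto_deriv_sq {g g' : ℝ → ℝ} {a b : ℝ} (hg : ∀ z, HasDerivAt g (g' z) z)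
    (ha : Tendsto g atTop (𝓝 a)) (hb : Tendsto (fun z => g' z ^ 2) atTop (𝓝 b)) : b = 0 := by
  obtain ⟨ξ, h1, h2⟩ := exists_seq_tendsto_deriv_zero hg ha
  exact tendsto_nhds_unique (hb.comp h1) (by simpa [Function.comp_def] using h2.pow 2)

theorem ExpTendstoTop.tendsto {g : ℝ → ℝ} {a : ℝ} (h : ExpTendstoTop g a) :
    Tendsto g atTop (𝓝 a) := by
  obtain ⟨C, κ, hκ, h⟩ := h
  rw [tendsto_iff_dist_tendsto_zero]
  have h1 : Tendsto (fun z => C * Real.exp (-κ * z)) atTop (𝓝 0) := by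
    have : Tendsto (fun z : ℝ => -κ * z) atTop atBot :=
      tendsto_id.const_mul_atTop_of_neg (by linarith)
    simpa using (Real.tendsto_exp_atBot.comp this).const_mul C
  refine squeeze_zero' (Eventually.of_forall fun _ => dist_nonneg) ?_ h1
  filter_upwards [eventually_ge_atTop 0] with z hz using h z hz

/-! ### Profile equation and conservation laws -/

/-- The potential `∫_{q₀}^x (f r - f q₀) dr` of the nonlinearity, normalized at the background. -/
noncomputable def bgPotential (f : ℝ → ℝ) (q₀ x : ℝ) : ℝ := ∫ r in q₀..x, (f r - f q₀)

theorem hasDerivAt_bgPotential {f : ℝ → ℝ} (hf : Continuous f) (q₀ x : ℝ) :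
    HasDerivAt (bgPotential f q₀) (f x - f q₀) x :=
  intervalIntegral.integral_hasDerivAt_right
    ((hf.sub continuous_const).intervalIntegrable _ _)
    ((hf.sub continuous_const).stronglyMeasurableAtFilter _ _)
    (hf.sub continuous_const).continuousAt

theorem continuous_bgPotential {f : ℝ → ℝ} (hf : Continuous f) (q₀ : ℝ) :
    Continuous (bgPotential f q₀) :=
  continuous_iff_continuousAt.2 fun x => (hasDerivAt_bgPotential hf q₀ x).continuousAt

theorem bgPotential_self (f : ℝ → ℝ) (q₀ : ℝ) : bgPotential f q₀ q₀ = 0 := by simp [bgPotential]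

theorem contDiff_bgPotential {f : ℝ → ℝ} (hf : ContDiff ℝ 2 f) (q₀ : ℝ) :
    ContDiff ℝ 3 (bgPotential f q₀) := by
  rw [show (3 : WithTop ℕ∞) = 2 + 1 by norm_num, contDiff_succ_iff_deriv]
  refine ⟨fun x => (hasDerivAt_bgPotential hf.continuous q₀ x).differentiableAt, by simp, ?_⟩
  rw [show deriv (bgPotential f q₀) = fun x => f x - f q₀ from
    funext fun x => (hasDerivAt_bgPotential hf.continuous q₀ x).deriv]
  exact hf.sub contDiff_const

theorem profile_ode {f : ℝ → ℝ} {ω v : ℝ} {U : ℝ → ℂ} (hU : ContDiff ℝ 2 U)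
    (h : IsNLSSolution f (fun x t => U (x - v * t) * Complex.exp (-Complex.I * (ω : ℂ) * (t : ℂ))))
    (x : ℝ) :
    HasDerivAt (deriv U)
      (2 * Complex.I * v * deriv U x + 2 * ((f (‖U x‖ ^ 2) - ω : ℝ) : ℂ) * U x) x := by
  have hd : ∀ x, HasDerivAt U (deriv U x) x := fun x =>
    (hU.differentiable (by norm_num) x).hasDerivAt
  have hd2 : HasDerivAt (deriv U) (deriv (deriv U) x) x := by
    have : ContDiff ℝ 1 (deriv U) := by
      rw [show (2 : WithTop ℕ∞) = 1 + 1 by norm_num, contDiff_succ_iff_deriv] at hU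
      exact hU.2.2
    exact (this.differentiable (by norm_num) x).hasDerivAt
  have h0 := h.2 x 0
  have e1 : HasDerivAt (fun s : ℝ => U (x - v * s) * Complex.exp (-Complex.I * (ω : ℂ) * (s : ℂ)))
      (-v * deriv U x - Complex.I * ω * U x) 0 := by
    have a1 : HasDerivAt (fun s : ℝ => x - v * s) (-v) 0 := by
      simpa using ((hasDerivAt_id (0 : ℝ)).const_mul v).const_sub x
    have a2 : HasDerivAt (fun s : ℝ => U (x - v * s)) ((-v) • deriv U x) 0 :=
      HasDerivAt.scomp (h := fun s : ℝ => x - v * s) (0 : ℝ) (by simpa using hd x) a1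
    have a3 : HasDerivAt (fun s : ℝ => Complex.exp (-Complex.I * (ω : ℂ) * (s : ℂ)))
        (-Complex.I * ω) 0 := by
      have := ((Complex.ofRealCLM.hasDerivAt (x := (0 : ℝ))).const_mul (-Complex.I * (ω : ℂ))).cexp
      simpa using this
    have := a2.mul a3
    convert! this using 1
    simp
    ring
  have e2 : iteratedDeriv 2
      (fun y => U (y - v * 0) * Complex.exp (-Complex.I * (ω : ℂ) * ((0 : ℝ) : ℂ))) x
      = deriv (deriv U) x := by
    simp [iteratedDeriv_succ, iteratedDeriv_zero]
  simp only [e1.deriv, e2] at h0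
  have e3 : deriv (deriv U) x
      = 2 * Complex.I * v * deriv U x + 2 * ((f (‖U x‖ ^ 2) - ω : ℝ) : ℂ) * U x := by
    simp only [mul_zero, sub_zero, Complex.ofReal_zero, Complex.exp_zero, mul_one] at h0
    push_cast
    linear_combination 2 * h0 + 2 * ω * U x * Complex.I_sq
  rwa [e3] at hd2

/-- The hydrodynamic conservation laws of a profile in real coordinates. -/
theorem profile_first_integrals {f : ℝ → ℝ} {q₀ v : ℝ} (hf : Continuous f) (hq₀ : 0 < q₀)
    {X Y P S : ℝ → ℝ}
    (hX : ∀ z, HasDerivAt X (P z) z) (hY : ∀ z, HasDerivAt Y (S z) z)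
    (hP : ∀ z, HasDerivAt P
      (-(2 * v * S z) + 2 * (f (X z ^ 2 + Y z ^ 2) - f q₀) * X z) z)
    (hS : ∀ z, HasDerivAt S
      (2 * v * P z + 2 * (f (X z ^ 2 + Y z ^ 2) - f q₀) * Y z) z)
    (hXl : Tendsto X atTop (𝓝 (Real.sqrt q₀))) (hYl : Tendsto Y atTop (𝓝 0)) (z : ℝ) :
    X z * S z - Y z * P z = v * (X z ^ 2 + Y z ^ 2 - q₀) ∧
      P z ^ 2 + S z ^ 2 = 2 * bgPotential f q₀ (X z ^ 2 + Y z ^ 2) := by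
  have hsq : Real.sqrt q₀ ^ 2 = q₀ := Real.sq_sqrt hq₀.le
  have hρ : ∀ z, HasDerivAt (fun z => X z ^ 2 + Y z ^ 2) (2 * X z * P z + 2 * Y z * S z) z := by
    intro z
    have := ((hX z).pow 2).add ((hY z).pow 2)
    convert! this using 1
    simp
  have hρl : Tendsto (fun z => X z ^ 2 + Y z ^ 2) atTop (𝓝 q₀) := by
    have := (hXl.pow 2).add (hYl.pow 2)
    simpa [hsq] using this
  have hj : ∀ z, HasDerivAt (fun z => X z * S z - Y z * P z - v * (X z ^ 2 + Y z ^ 2)) 0 z := by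
    intro z
    have := (((hX z).mul (hS z)).sub ((hY z).mul (hP z))).sub ((hρ z).const_mul v)
    convert! this using 1
    ring
  have hE : ∀ z, HasDerivAt
      (fun z => P z ^ 2 + S z ^ 2 - 2 * bgPotential f q₀ (X z ^ 2 + Y z ^ 2)) 0 z := by
    intro z
    have := (((hP z).pow 2).add ((hS z).pow 2)).sub
      (((hasDerivAt_bgPotential hf q₀ _).comp z (hρ z)).const_mul 2)
    convert! this using 1
    simp
    ring
  have cj := fun z => is_const_of_deriv_eq_zero (fun z => (hj z).differentiableAt)
    (fun z => (hj z).deriv) z 0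
  have cE := fun z => is_const_of_deriv_eq_zero (fun z => (hE z).differentiableAt)
    (fun z => (hE z).deriv) z 0
  -- `D` and `E` are the two conserved values. Decay of U' is not assumed, so they are identified
  -- through limits at +∞.
  set D := X 0 * S 0 - Y 0 * P 0 - v * (X 0 ^ 2 + Y 0 ^ 2)
  set E := P 0 ^ 2 + S 0 ^ 2 - 2 * bgPotential f q₀ (X 0 ^ 2 + Y 0 ^ 2)
  have hEl : Tendsto (fun z => P z ^ 2 + S z ^ 2) atTop (𝓝 E) := by
    have h1 := ((((continuous_bgPotential hf q₀).tendsto q₀).comp hρl).const_mul 2).const_add E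
    rw [bgPotential_self] at h1
    simp only [mul_zero, add_zero] at h1
    refine h1.congr fun z => ?_
    have := cE z
    simp only [Function.comp]
    linarith
  -- |U'|² is bounded near +∞ since it tends to `E`, and Y tends to 0.
  have hYP : Tendsto (fun z => Y z * P z) atTop (𝓝 0) := by
    have h1 : Tendsto (fun z => Y z ^ 2 * (P z ^ 2 + S z ^ 2)) atTop (𝓝 0) := by
      simpa using (hYl.pow 2).mul hEl
    have h2 : Tendsto (fun z => (Y z * P z) ^ 2) atTop (𝓝 0) :=
      squeeze_zero (fun z => sq_nonneg _) (fun z => by nlinarith [sq_nonneg (Y z * S z)]) h1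
    have h3 := (Real.continuous_sqrt.tendsto 0).comp h2
    rw [tendsto_zero_iff_abs_tendsto_zero]
    simpa [Function.comp_def, Real.sqrt_sq_eq_abs] using h3
  have hs0 : Real.sqrt q₀ ≠ 0 := (Real.sqrt_pos.2 hq₀).ne'
  -- The first law, solved for S, shows that S has a limit; as S is the derivative of the convergent
  -- Y, this limit is 0, which fixes `D`. Then P² tends to `E`, and convergence of X forces `E = 0`.
  have hSl : Tendsto S atTop (𝓝 ((D + v * q₀) / Real.sqrt q₀)) := by
    have h1 : Tendsto (fun z => (Y z * P z + D + v * (X z ^ 2 + Y z ^ 2)) / X z) atTop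
        (𝓝 ((0 + D + v * q₀) / Real.sqrt q₀)) :=
      ((hYP.add_const D).add (hρl.const_mul v)).div hXl hs0
    rw [zero_add] at h1
    refine h1.congr' ?_
    filter_upwards [hXl.eventually_ne hs0] with z hz
    rw [div_eq_iff hz]
    have := cj z
    linarith
  have hD := eq_zero_of_tendsto_deriv hY hYl hSl
  have hD' : D = -(v * q₀) := by
    rcases div_eq_zero_iff.1 hD with h | h
    · linarith
    · exact absurd h hs0
  have hE' : E = 0 := by
    rw [hD] at hSl
    refine eq_zero_of_tendsto_deriv_sq hX hXl ?_
    simpa using hEl.sub (hSl.pow 2)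
  constructor
  · linarith [cj z]
  · linarith [cE z]

/-! ### The density as a solution of a Newton equation -/

/-- The squared modulus `ρ` of a travelling profile, as a solution of a Newton equation. -/
structure IsDensityProfile (f : ℝ → ℝ) (q₀ m : ℝ) (ρ ρ' : ℝ → ℝ) : Prop where
  hasDerivAt : ∀ z, HasDerivAt ρ (ρ' z) z
  hasDerivAt' : ∀ z, HasDerivAt ρ' (4 * bgPotential f q₀ (ρ z) + 4 * ρ z * (f (ρ z) - f q₀)
    + 4 * m * (q₀ - ρ z)) z
  sq_eq : ∀ z, ρ' z ^ 2 = 8 * ρ z * bgPotential f q₀ (ρ z) - 4 * m * (q₀ - ρ z) ^ 2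
  pos : ∀ z, 0 < ρ z
  lt : ∀ z, ρ z < q₀
  deriv_zero : ρ' 0 = 0
  exp_bound : ∃ C κ : ℝ, 0 < κ ∧ ∀ z, 0 ≤ z → q₀ - ρ z ≤ C * Real.exp (-κ * z)
  tendsto : Tendsto ρ atTop (𝓝 q₀)

theorem IsDarkSoliton.isDensityProfile {f : ℝ → ℝ} {q₀ v : ℝ} {U : ℝ → ℂ} (hf : Continuous f)
    (hq₀ : 0 < q₀) (hv : v ≠ 0) (h : IsDarkSoliton f q₀ (f q₀) v U) :
    (∃ ρ', IsDensityProfile f q₀ (v ^ 2) (fun z => ‖U z‖ ^ 2) ρ') ∧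
      ∀ z, momentumDensity q₀ U z = ((-v * ((q₀ - ‖U z‖ ^ 2) ^ 2 / ‖U z‖ ^ 2) : ℝ) : ℂ) := by
  obtain ⟨hN, Φ, Θ, Θm, hU, hΦ, hΘ, hUe, hΦb, -, hΦt, -, hΘt, -, hΦ0⟩ := h
  have hsq : Real.sqrt q₀ ^ 2 = q₀ := Real.sq_sqrt hq₀.le
  have hn : ∀ z, ‖U z‖ ^ 2 = (U z).re ^ 2 + (U z).im ^ 2 := fun z => by
    rw [← Complex.normSq_eq_norm_sq, Complex.normSq_apply]; ring
  have hnΦ : ∀ z, ‖U z‖ ^ 2 = Φ z ^ 2 := fun z => by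
    rw [hUe, norm_mul, mul_comm Complex.I, Complex.norm_exp_ofReal_mul_I]
    simp
  have hd : ∀ x, HasDerivAt U (deriv U x) x := fun x =>
    (hU.differentiable (by norm_num) x).hasDerivAt
  have hd2 := profile_ode hU hN
  have hX : ∀ z, HasDerivAt (fun z => (U z).re) (deriv U z).re z := fun z =>
    Complex.reCLM.hasFDerivAt.comp_hasDerivAt z (hd z)
  have hY : ∀ z, HasDerivAt (fun z => (U z).im) (deriv U z).im z := fun z =>
    Complex.imCLM.hasFDerivAt.comp_hasDerivAt z (hd z)
  have hP : ∀ z, HasDerivAt (fun z => (deriv U z).re) (-(2 * v * (deriv U z).im)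
      + 2 * (f ((U z).re ^ 2 + (U z).im ^ 2) - f q₀) * (U z).re) z := fun z => by
    have := Complex.reCLM.hasFDerivAt.comp_hasDerivAt z (hd2 z)
    convert! this using 1
    simp [hn]
  have hS : ∀ z, HasDerivAt (fun z => (deriv U z).im) (2 * v * (deriv U z).re
      + 2 * (f ((U z).re ^ 2 + (U z).im ^ 2) - f q₀) * (U z).im) z := fun z => by
    have := Complex.imCLM.hasFDerivAt.comp_hasDerivAt z (hd2 z)
    convert! this using 1
    simp [hn]
  have hUl : Tendsto U atTop (𝓝 (Real.sqrt q₀ : ℂ)) := by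
    have h1 : Tendsto (fun z => ((Φ z : ℝ) : ℂ)) atTop (𝓝 (Real.sqrt q₀ : ℂ)) :=
      (Complex.continuous_ofReal.tendsto _).comp hΦt.tendsto
    have h2 : Tendsto (fun z => Complex.exp (Complex.I * (Θ z : ℂ))) atTop (𝓝 1) := by
      have : Continuous fun t : ℝ => Complex.exp (Complex.I * (t : ℂ)) := by fun_prop
      simpa [Function.comp_def] using (this.tendsto 0).comp hΘt.tendsto
    have h3 := h1.mul h2
    rw [mul_one] at h3
    exact h3.congr fun z => (hUe z).symm
  have hXl : Tendsto (fun z => (U z).re) atTop (𝓝 (Real.sqrt q₀)) := by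
    simpa [Function.comp_def] using (Complex.continuous_re.tendsto _).comp hUl
  have hYl : Tendsto (fun z => (U z).im) atTop (𝓝 0) := by
    simpa [Function.comp_def] using (Complex.continuous_im.tendsto _).comp hUl
  have hI := profile_first_integrals hf hq₀ hX hY hP hS hXl hYl
  have hρeq : (fun z => ‖U z‖ ^ 2) = fun z => (U z).re ^ 2 + (U z).im ^ 2 := funext hn
  have hρ : ∀ z, HasDerivAt (fun z => ‖U z‖ ^ 2)
      (2 * (U z).re * (deriv U z).re + 2 * (U z).im * (deriv U z).im) z := by
    intro z
    rw [hρeq]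
    have := ((hX z).pow 2).add ((hY z).pow 2)
    convert! this using 1
    simp
  -- At a zero of U the first conservation law would read 0 = −v q₀; this is where v ≠ 0 enters.
  have hpos : ∀ z, 0 < ‖U z‖ ^ 2 := by
    intro z
    by_contra hc
    have h0 : U z = 0 := by
      by_contra h0
      exact hc (by positivity)
    have := (hI z).1
    simp [h0, hv, hq₀.ne'] at this
  refine ⟨⟨fun z => 2 * (U z).re * (deriv U z).re + 2 * (U z).im * (deriv U z).im,
    hρ, fun z => ?_, fun z => ?_, hpos, fun z => ?_, ?_, ?_, ?_⟩, fun z => ?_⟩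
  · have h1 := (((hX z).const_mul 2).mul (hP z)).add (((hY z).const_mul 2).mul (hS z))
    convert! h1 using 1
    simp only [hn]
    linear_combination (-2) * (hI z).2 + 4 * v * (hI z).1
  · simp only [hn]
    -- Lagrange's identity: (X² + Y²)(P² + S²) = (XP + YS)² + (XS − YP)².
    linear_combination (4 * ((U z).re ^ 2 + (U z).im ^ 2)) * (hI z).2 -
      4 * ((U z).re * (deriv U z).im - (U z).im * (deriv U z).re
        + v * ((U z).re ^ 2 + (U z).im ^ 2 - q₀)) * (hI z).1
  · simp only [hnΦ]
    nlinarith [hΦb z]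
  · have h1 : HasDerivAt (fun z => ‖U z‖ ^ 2) (2 * Φ 0 * deriv Φ 0) 0 := by
      rw [show (fun z => ‖U z‖ ^ 2) = fun z => Φ z ^ 2 from funext hnΦ]
      have := ((hΦ.differentiable (by norm_num) 0).hasDerivAt).pow 2
      convert! this using 1
      simp
    rw [hΦ0, mul_zero] at h1
    exact (hρ 0).unique h1
  · obtain ⟨C, κ, hκ, hC⟩ := hΦt
    refine ⟨2 * Real.sqrt q₀ * C, κ, hκ, fun z hz => ?_⟩
    have h1 := hC z hz
    have h2 := hΦb z
    rw [abs_of_nonpos (by linarith)] at h1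
    simp only [hnΦ]
    have : q₀ - Φ z ^ 2 = (Real.sqrt q₀ + Φ z) * (Real.sqrt q₀ - Φ z) := by
      linear_combination -hsq
    rw [this, mul_assoc]
    exact mul_le_mul (by linarith) (by linarith) (by linarith) (by positivity)
  · simp only [hnΦ]
    simpa [hsq] using hΦt.tendsto.pow 2
  · have h1 : deriv (fun y => conj (U y)) z = conj (deriv U z) := deriv.star
    have h2 : conj (U z) * deriv U z - U z * conj (deriv U z)
        = 2 * Complex.I * ((v * (‖U z‖ ^ 2 - q₀) : ℝ) : ℂ) := by
      rw [hn, ← (hI z).1]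
      apply Complex.ext <;> simp
      ring
    have h3 : ((‖U z‖ ^ 2 : ℝ) : ℂ) ≠ 0 := by exact_mod_cast (hpos z).ne'
    rw [momentumDensity, h1, h2]
    generalize ‖U z‖ ^ 2 = r at *
    push_cast
    field_simp
    linear_combination (-(v : ℂ)) * (r - q₀) ^ 2 * (-Complex.I_sq)

/-- Uniqueness for the Newton equation `ρ'' = N(ρ)` among solutions with values in `[a, b]`. -/
theorem newton_unique {N : ℝ → ℝ} (hN : ContDiff ℝ 1 N) {a b t₀ : ℝ} {ρ ρ' σ σ' : ℝ → ℝ}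
    (hρ : ∀ z, HasDerivAt ρ (ρ' z) z) (hρ' : ∀ z, HasDerivAt ρ' (N (ρ z)) z)
    (hρm : ∀ z, ρ z ∈ Icc a b)
    (hσ : ∀ z, HasDerivAt σ (σ' z) z) (hσ' : ∀ z, HasDerivAt σ' (N (σ z)) z)
    (hσm : ∀ z, σ z ∈ Icc a b) (h0 : ρ t₀ = σ t₀) (h1 : ρ' t₀ = σ' t₀) : ρ = σ := by
  obtain ⟨K, hK⟩ := (hN.locallyLipschitz.locallyLipschitzOn (s := Icc a b)).exists_lipschitzOnWith_of_compact
    isCompact_Icc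
  have hL : LipschitzOnWith (max 1 (K * 1)) (fun p : ℝ × ℝ => (p.2, N p.1)) (Icc a b ×ˢ univ) :=
    (LipschitzWith.prod_snd.lipschitzOnWith).prodMk
      (hK.comp LipschitzWith.prod_fst.lipschitzOnWith fun p hp => hp.1)
  have := ODE_solution_unique_univ (v := fun _ p => (p.2, N p.1)) (s := fun _ => Icc a b ×ˢ univ)
    (f := fun z => (ρ z, ρ' z)) (g := fun z => (σ z, σ' z)) (t₀ := t₀) (fun _ => hL)
    (fun z => ⟨(hρ z).prodMk (hρ' z), hρm z, mem_univ _⟩)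
    (fun z => ⟨(hσ z).prodMk (hσ' z), hσm z, mem_univ _⟩) (by simp [h0, h1])
  funext z
  exact congrArg Prod.fst (congrFun this z)

/-! ### The level function of turning points -/

/-- The squared speed at which `x` is a turning point of the density. -/
noncomputable def speedSq (f : ℝ → ℝ) (q₀ x : ℝ) : ℝ := 2 * x * bgPotential f q₀ x / (q₀ - x) ^ 2

theorem contDiffAt_speedSq {f : ℝ → ℝ} (hf : ContDiff ℝ 2 f) {q₀ x : ℝ} (hx : x < q₀) :
    ContDiffAt ℝ 3 (speedSq f q₀) x := by
  have hF := (contDiff_bgPotential hf q₀).contDiffAt (x := x)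
  exact ContDiffAt.div (by fun_prop) (by fun_prop) (by have := sub_pos.2 hx; positivity)

theorem hasDerivAt_speedSq {f : ℝ → ℝ} (hf : ContDiff ℝ 2 f) {q₀ x : ℝ} (hx : x < q₀) :
    HasDerivAt (speedSq f q₀) (deriv (speedSq f q₀) x) x :=
  ((contDiffAt_speedSq hf hx).differentiableAt (by norm_num)).hasDerivAt

theorem contDiffAt_deriv_speedSq {f : ℝ → ℝ} (hf : ContDiff ℝ 2 f) {q₀ x : ℝ} (hx : x < q₀) :
    ContDiffAt ℝ 2 (deriv (speedSq f q₀)) x :=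
  ContDiffAt.derivWithin (contDiffAt_speedSq hf hx) (by norm_num)

theorem mul_speedSq (f : ℝ → ℝ) {q₀ x : ℝ} (hx : x < q₀) :
    (q₀ - x) ^ 2 * speedSq f q₀ x = 2 * x * bgPotential f q₀ x := by
  have : q₀ - x ≠ 0 := (sub_pos.2 hx).ne'
  rw [speedSq]; field_simp

/-- The force of the Newton equation in terms of `speedSq`. -/
theorem newton_force_eq {f : ℝ → ℝ} (hf : ContDiff ℝ 2 f) {q₀ x : ℝ} (hx : x < q₀) (m : ℝ) :
    4 * bgPotential f q₀ x + 4 * x * (f x - f q₀) + 4 * m * (q₀ - x)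
      = 2 * (q₀ - x) ^ 2 * deriv (speedSq f q₀) x - 4 * (q₀ - x) * (speedSq f q₀ x - m) := by
  have h1 : HasDerivAt (fun x => (q₀ - x) ^ 2 * speedSq f q₀ x)
      (-(2 * (q₀ - x)) * speedSq f q₀ x + (q₀ - x) ^ 2 * deriv (speedSq f q₀) x) x := by
    have := (((hasDerivAt_id x).const_sub q₀).pow 2).mul (hasDerivAt_speedSq hf hx)
    convert! this using 1
    simp
  have h2 : HasDerivAt (fun x => (q₀ - x) ^ 2 * speedSq f q₀ x)
      (2 * bgPotential f q₀ x + 2 * x * (f x - f q₀)) x := by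
    have := ((hasDerivAt_id x).const_mul 2).mul (hasDerivAt_bgPotential hf.continuous q₀ x)
    refine HasDerivAt.congr_of_eventuallyEq (f := fun x => 2 * x * bgPotential f q₀ x) ?_ ?_
    · convert! this using 1
      simp
    · filter_upwards [Iio_mem_nhds hx] with y hy using mul_speedSq f hy
  linear_combination 2 * h2.unique h1

/-! ### Shape of the density and change of variable in the momentum -/

namespace IsDensityProfile

variable {f : ℝ → ℝ} {q₀ m : ℝ} {ρ ρ' : ℝ → ℝ}

theorem contDiff_force (hf : ContDiff ℝ 2 f) (q₀ m : ℝ) : ContDiff ℝ 1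
    fun x => 4 * bgPotential f q₀ x + 4 * x * (f x - f q₀) + 4 * m * (q₀ - x) := by
  have h1 : ContDiff ℝ 1 (bgPotential f q₀) := (contDiff_bgPotential hf q₀).of_le (by norm_num)
  have h2 : ContDiff ℝ 1 f := hf.of_le (by norm_num)
  fun_prop

theorem mem_Icc (h : IsDensityProfile f q₀ m ρ ρ') (z : ℝ) : ρ z ∈ Icc 0 q₀ :=
  ⟨(h.pos z).le, (h.lt z).le⟩

theorem sq_eq_speedSq (h : IsDensityProfile f q₀ m ρ ρ') (z : ℝ) :
    ρ' z ^ 2 = 4 * (q₀ - ρ z) ^ 2 * (speedSq f q₀ (ρ z) - m) := by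
  rw [h.sq_eq]
  linear_combination (-4) * mul_speedSq f (h.lt z)

/-- The Newton equation is reversible, so at a critical point the profile and its mirror image have
the same Cauchy data. -/
theorem reflect (hf : ContDiff ℝ 2 f) (h : IsDensityProfile f q₀ m ρ ρ') {z₁ : ℝ}
    (hz : ρ' z₁ = 0) (z : ℝ) : ρ (2 * z₁ - z) = ρ z := by
  have hr : ∀ z, HasDerivAt (fun z => 2 * z₁ - z) (-1) z := fun z =>
    (hasDerivAt_id z).const_sub _
  refine congrFun (newton_unique (contDiff_force hf q₀ m) (t₀ := z₁) (a := 0) (b := q₀)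
    (ρ := fun z => ρ (2 * z₁ - z))
    (ρ' := fun z => -ρ' (2 * z₁ - z)) (σ' := ρ') (fun z => ?_) (fun z => ?_)
    (fun z => h.mem_Icc _) h.hasDerivAt h.hasDerivAt' h.mem_Icc ?_ ?_) z
  · have := (h.hasDerivAt (2 * z₁ - z)).comp z (hr z)
    convert! this using 1
    ring
  · have := ((h.hasDerivAt' (2 * z₁ - z)).comp z (hr z)).neg
    convert! this using 1
    ring
  · simp [two_mul]
  · simp [two_mul, hz]

theorem even (hf : ContDiff ℝ 2 f) (h : IsDensityProfile f q₀ m ρ ρ') (z : ℝ) : ρ (-z) = ρ z := by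
  simpa using h.reflect hf h.deriv_zero z

/-- A second critical point z would combine the reflections about 0 and z into a translation by 2z.
A profile of period 2z cannot tend to q₀ while ρ(0) < q₀. -/
theorem deriv_ne_zero (hf : ContDiff ℝ 2 f) (h : IsDensityProfile f q₀ m ρ ρ') {z : ℝ}
    (hz : 0 < z) : ρ' z ≠ 0 := by
  intro hz0
  have hper : ∀ n : ℕ, ρ (2 * z * n) = ρ 0 := by
    intro n
    induction n with
    | zero => simp
    | succ n ih =>
      rw [← ih, ← h.reflect hf hz0, ← h.even hf]
      congr 1
      push_cast
      ring
  have hl : Tendsto (fun n : ℕ => ρ (2 * z * n)) atTop (𝓝 q₀) :=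
    h.tendsto.comp (tendsto_natCast_atTop_atTop.const_mul_atTop (by positivity))
  simp only [hper] at hl
  exact (h.lt 0).ne (tendsto_nhds_unique tendsto_const_nhds hl)

/-- A nonvanishing derivative has constant sign (Darboux), and a decreasing profile would have ρ(0)
≥ q₀. -/
theorem deriv_pos (hf : ContDiff ℝ 2 f) (h : IsDensityProfile f q₀ m ρ ρ') {z : ℝ}
    (hz : 0 < z) : 0 < ρ' z := by
  rcases hasDerivWithinAt_forall_lt_or_forall_gt_of_forall_ne (convex_Ioi (0 : ℝ))
    (fun x _ => (h.hasDerivAt x).hasDerivWithinAt) (fun x hx => h.deriv_ne_zero hf hx) with H | H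
  · have hanti : AntitoneOn ρ (Ici 0) := antitoneOn_of_hasDerivWithinAt_nonpos (convex_Ici 0)
      (fun z _ => (h.hasDerivAt z).continuousAt.continuousWithinAt)
      (fun x _ => (h.hasDerivAt x).hasDerivWithinAt)
      (fun x hx => (H x (by simpa using hx)).le)
    have : q₀ ≤ ρ 0 := by
      refine le_of_tendsto h.tendsto ?_
      filter_upwards [eventually_ge_atTop 0] with x hx
      exact hanti (mem_Ici.2 le_rfl) hx hx
    exact absurd (h.lt 0) this.not_gt
  · exact H z hz

theorem strictMonoOn (hf : ContDiff ℝ 2 f) (h : IsDensityProfile f q₀ m ρ ρ') :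
    StrictMonoOn ρ (Ici 0) :=
  strictMonoOn_of_hasDerivWithinAt_pos (convex_Ici 0)
    (fun z _ => (h.hasDerivAt z).continuousAt.continuousWithinAt)
    (fun x _ => (h.hasDerivAt x).hasDerivWithinAt)
    (fun x hx => h.deriv_pos hf (by simpa using hx))

theorem image_Ioi (hf : ContDiff ℝ 2 f) (h : IsDensityProfile f q₀ m ρ ρ') :
    ρ '' Ioi 0 = Ioo (ρ 0) q₀ := by
  apply Subset.antisymm
  · rintro _ ⟨z, hz, rfl⟩
    exact ⟨h.strictMonoOn hf (mem_Ici.2 le_rfl) (mem_Ioi.1 hz).le hz, h.lt z⟩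
  · rintro x ⟨hx1, hx2⟩
    obtain ⟨b, hb0, hb⟩ := ((eventually_gt_atTop 0).and
      (h.tendsto.eventually (lt_mem_nhds hx2))).exists
    obtain ⟨z, hz, rfl⟩ := intermediate_value_Ioo hb0.le
      (fun z _ => (h.hasDerivAt z).continuousAt.continuousWithinAt) ⟨hx1, hb⟩
    exact ⟨z, hz.1, rfl⟩

theorem speedSq_zero (h : IsDensityProfile f q₀ m ρ ρ') : speedSq f q₀ (ρ 0) = m := by
  have h1 := h.sq_eq_speedSq 0
  have h2 := sub_pos.2 (h.lt 0)
  rw [h.deriv_zero] at h1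
  have : speedSq f q₀ (ρ 0) - m = 0 := by
    have h3 : 4 * (q₀ - ρ 0) ^ 2 ≠ 0 := by positivity
    have h4 : 4 * (q₀ - ρ 0) ^ 2 * (speedSq f q₀ (ρ 0) - m) = 0 := by rw [← h1]; simp
    exact (mul_eq_zero.1 h4).resolve_left h3
  linarith

theorem lt_speedSq (hf : ContDiff ℝ 2 f) (h : IsDensityProfile f q₀ m ρ ρ') {x : ℝ}
    (hx : x ∈ Ioo (ρ 0) q₀) : m < speedSq f q₀ x := by
  rw [← h.image_Ioi hf] at hx
  obtain ⟨z, hz, rfl⟩ := hx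
  have h1 := pow_pos (h.deriv_pos hf hz) 2
  rw [h.sq_eq_speedSq] at h1
  have := pos_of_mul_pos_right h1 (by positivity)
  linarith

theorem deriv_eq (hf : ContDiff ℝ 2 f) (h : IsDensityProfile f q₀ m ρ ρ') {z : ℝ} (hz : 0 < z) :
    ρ' z = 2 * (q₀ - ρ z) * Real.sqrt (speedSq f q₀ (ρ z) - m) := by
  have h1 := sub_pos.2 (h.lt z)
  rw [← Real.sqrt_sq (h.deriv_pos hf hz).le, h.sq_eq_speedSq,
    show 4 * (q₀ - ρ z) ^ 2 = (2 * (q₀ - ρ z)) ^ 2 by ring, Real.sqrt_mul (by positivity),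
    Real.sqrt_sq (by positivity)]

/-- At z = 0 the force is a positive multiple of H'(ρ(0)). It is nonzero, since otherwise ρ(0) is an
equilibrium and ρ is constant. It is nonnegative because ρ' vanishes at 0 and is positive to the
right. -/
theorem deriv_speedSq_pos (hf : ContDiff ℝ 2 f) (h : IsDensityProfile f q₀ m ρ ρ') :
    0 < deriv (speedSq f q₀) (ρ 0) := by
  have h0 := sub_pos.2 (h.lt 0)
  have hN := newton_force_eq hf (h.lt 0) m
  rw [h.speedSq_zero, sub_self, mul_zero, sub_zero] at hN
  have hN0 : 2 * (q₀ - ρ 0) ^ 2 * deriv (speedSq f q₀) (ρ 0) ≠ 0 := by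
    intro hc
    rw [hc] at hN
    have : ρ = fun _ => ρ 0 := by
      refine newton_unique (contDiff_force hf q₀ m) (t₀ := 0) (a := 0) (b := q₀) (σ' := fun _ => 0)
        h.hasDerivAt h.hasDerivAt' h.mem_Icc (fun z => hasDerivAt_const _ _) (fun z => ?_)
        (fun _ => h.mem_Icc 0) rfl h.deriv_zero
      rw [hN]
      exact hasDerivAt_const _ _
    have hl := h.tendsto
    rw [this] at hl
    exact (h.lt 0).ne (tendsto_nhds_unique tendsto_const_nhds hl)
  have hN1 : 0 ≤ 2 * (q₀ - ρ 0) ^ 2 * deriv (speedSq f q₀) (ρ 0) := by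
    have h1 := h.hasDerivAt' 0
    rw [hN, hasDerivAt_iff_tendsto_slope] at h1
    have h2 := h1.mono_left (nhdsGT_le_nhdsNE (0 : ℝ))
    refine ge_of_tendsto h2 ?_
    filter_upwards [self_mem_nhdsWithin] with z hz
    rw [slope_def_field, h.deriv_zero, sub_zero, sub_zero]
    exact div_nonneg (h.deriv_pos hf hz).le (mem_Ioi.1 hz).le
  exact pos_of_mul_pos_right (lt_of_le_of_ne hN1 hN0.symm) (by positivity)

theorem apply_zero_le (hf : ContDiff ℝ 2 f) (h : IsDensityProfile f q₀ m ρ ρ') {z : ℝ}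
    (hz : 0 ≤ z) : ρ 0 ≤ ρ z :=
  (h.strictMonoOn hf).monotoneOn (mem_Ici.2 le_rfl) hz hz

theorem integrableOn_Ioi (hf : ContDiff ℝ 2 f) (h : IsDensityProfile f q₀ m ρ ρ') :
    IntegrableOn (fun z => (q₀ - ρ z) ^ 2 / ρ z) (Ioi 0) := by
  obtain ⟨C, κ, hκ, hC⟩ := h.exp_bound
  have hcont : Continuous ρ := continuous_iff_continuousAt.2 fun z => (h.hasDerivAt z).continuousAt
  have hm : Continuous fun z => (q₀ - ρ z) ^ 2 / ρ z :=
    ((continuous_const.sub hcont).pow 2).div hcont fun z => (h.pos z).ne'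
  refine Integrable.mono' (g := fun z => C ^ 2 / ρ 0 * Real.exp (-(2 * κ) * z)) ?_
    hm.aestronglyMeasurable ?_
  · exact (exp_neg_integrableOn_Ioi 0 (by positivity)).const_mul _
  · filter_upwards [ae_restrict_mem measurableSet_Ioi] with z hz
    have hz0 : (0 : ℝ) ≤ z := (mem_Ioi.1 hz).le
    have h1 := sub_pos.2 (h.lt z)
    have h2 : (q₀ - ρ z) ^ 2 ≤ (C * Real.exp (-κ * z)) ^ 2 :=
      pow_le_pow_left₀ h1.le (hC z hz0) 2
    have h3 := h.pos 0
    have h4 := h.pos z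
    rw [Real.norm_of_nonneg (by positivity)]
    calc (q₀ - ρ z) ^ 2 / ρ z ≤ (C * Real.exp (-κ * z)) ^ 2 / ρ 0 :=
          div_le_div₀ (by positivity) h2 h3 (h.apply_zero_le hf hz0)
      _ = C ^ 2 / ρ 0 * Real.exp (-(2 * κ) * z) := by
          rw [mul_pow, ← Real.exp_nat_mul]
          push_cast
          rw [show 2 * (-κ * z) = -(2 * κ) * z by ring]
          ring

theorem integrable (hf : ContDiff ℝ 2 f) (h : IsDensityProfile f q₀ m ρ ρ') :
    Integrable (fun z => (q₀ - ρ z) ^ 2 / ρ z) := by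
  have h1 := h.integrableOn_Ioi hf
  have h2 : IntegrableOn (fun z => (q₀ - ρ (-z)) ^ 2 / ρ (-z)) (Iio 0) :=
    IntegrableOn.comp_neg_Iio (f := fun z => (q₀ - ρ z) ^ 2 / ρ z) (c := 0) (by rwa [neg_zero])
  simp only [h.even hf] at h2
  have h3 := ((integrableOn_Iic_iff_integrableOn_Iio (μ := volume)).2 h2).union h1
  rwa [Iic_union_Ioi, integrableOn_univ] at h3

theorem smul_deriv (hf : ContDiff ℝ 2 f) (h : IsDensityProfile f q₀ m ρ ρ') {z : ℝ}
    (hz : z ∈ Ioi (0 : ℝ)) :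
    ρ' z • ((q₀ - ρ z) / (ρ z * Real.sqrt (speedSq f q₀ (ρ z) - m)))
      = 2 * ((q₀ - ρ z) ^ 2 / ρ z) := by
  have h1 : 0 < Real.sqrt (speedSq f q₀ (ρ z) - m) := by
    refine Real.sqrt_pos.2 (sub_pos.2 (h.lt_speedSq hf ?_))
    rw [← h.image_Ioi hf]
    exact mem_image_of_mem _ hz
  have h2 := h.pos z
  rw [h.deriv_eq hf hz, smul_eq_mul]
  field_simp

theorem integrableOn_density (hf : ContDiff ℝ 2 f) (h : IsDensityProfile f q₀ m ρ ρ') :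
    IntegrableOn (fun x => (q₀ - x) / (x * Real.sqrt (speedSq f q₀ x - m))) (Ioo (ρ 0) q₀) := by
  rw [← h.image_Ioi hf, integrableOn_image_iff_integrableOn_deriv_smul_of_monotoneOn
    measurableSet_Ioi (fun z _ => (h.hasDerivAt z).hasDerivWithinAt)
    ((h.strictMonoOn hf).monotoneOn.mono Ioi_subset_Ici_self),
    integrableOn_congr_fun (fun z hz => h.smul_deriv hf hz) measurableSet_Ioi]
  exact (h.integrableOn_Ioi hf).const_mul 2

/-- Evenness doubles the half-line integral, and the factor 2 cancels the one in ρ' = 2(q₀ −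
ρ)√(H(ρ) − m). -/
theorem integral_eq (hf : ContDiff ℝ 2 f) (h : IsDensityProfile f q₀ m ρ ρ') :
    ∫ z, (q₀ - ρ z) ^ 2 / ρ z
      = ∫ x in Ioo (ρ 0) q₀, (q₀ - x) / (x * Real.sqrt (speedSq f q₀ x - m)) := by
  rw [← h.image_Ioi hf, integral_image_eq_integral_deriv_smul_of_monotoneOn
    measurableSet_Ioi (fun z _ => (h.hasDerivAt z).hasDerivWithinAt)
    ((h.strictMonoOn hf).monotoneOn.mono Ioi_subset_Ici_self),
    setIntegral_congr_fun measurableSet_Ioi (fun z hz => h.smul_deriv hf hz),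
    integral_const_mul, ← integral_comp_abs]
  congr 1
  funext z
  rcases abs_choice z with hz | hz <;> rw [hz]
  rw [h.even hf]

end IsDensityProfile

/-! ### The last crossing of a level -/

/-- `R h` is the last point in `(0, q₀)` at which `H` takes the value `h`, and `H` crosses this value
transversally there. -/
structure IsLastCrossing (H : ℝ → ℝ) (q₀ M : ℝ) (R : ℝ → ℝ) : Prop where
  contDiffAt : ∀ x < q₀, ContDiffAt ℝ 3 H x
  pos : ∀ h ∈ Ioo 0 M, 0 < R h
  lt : ∀ h ∈ Ioo 0 M, R h < q₀
  apply_eq : ∀ h ∈ Ioo 0 M, H (R h) = h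
  deriv_pos : ∀ h ∈ Ioo 0 M, 0 < deriv H (R h)
  lt_apply : ∀ h ∈ Ioo 0 M, ∀ x ∈ Ioo (R h) q₀, h < H x

namespace IsLastCrossing

variable {H R : ℝ → ℝ} {q₀ M : ℝ}

theorem hasDerivAt_level (hR : IsLastCrossing H q₀ M R) {x : ℝ} (hx : x < q₀) :
    HasDerivAt H (deriv H x) x :=
  ((hR.contDiffAt x hx).differentiableAt (by norm_num)).hasDerivAt

theorem strictMonoOn (hR : IsLastCrossing H q₀ M R) : StrictMonoOn R (Ioo 0 M) := by
  intro h hh h' hh' hlt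
  rcases lt_trichotomy (R h) (R h') with H1 | H1 | H1
  · exact H1
  · have := hR.apply_eq h hh
    rw [H1, hR.apply_eq h' hh'] at this
    exact absurd this hlt.ne'
  · have := hR.lt_apply h' hh' (R h) ⟨H1, hR.lt h hh⟩
    rw [hR.apply_eq h hh] at this
    exact absurd this hlt.not_gt

theorem continuousAt (hR : IsLastCrossing H q₀ M R) {h : ℝ} (hh : h ∈ Ioo 0 M) :
    ContinuousAt R h := by
  have hI : Ioo 0 M ∈ 𝓝 h := Ioo_mem_nhds hh.1 hh.2
  have hd := hR.hasDerivAt_level (hR.lt h hh)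
  rw [ContinuousAt, tendsto_order]
  constructor
  -- Transversality gives x in (a, R h) with H x < h. For h' > H x, a last crossing at or below a
  -- would force h' < H x.
  · intro a ha
    have hs : ∀ᶠ x in 𝓝[<] (R h), 0 < slope H (R h) x :=
      ((hasDerivAt_iff_tendsto_slope.1 hd).mono_left (nhdsLT_le_nhdsNE _)).eventually
        (lt_mem_nhds (hR.deriv_pos h hh))
    have hs' : ∀ᶠ x in 𝓝[<] (R h), x ∈ Ioo a (R h) := Ioo_mem_nhdsLT ha
    obtain ⟨x, hxs, hxa, hx⟩ := (hs.and hs').exists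
    have hHx : H x < h := by
      rw [slope_def_field, hR.apply_eq h hh] at hxs
      by_contra hc
      push Not at hc
      exact absurd (div_nonpos_of_nonneg_of_nonpos (sub_nonneg.2 hc) (by linarith)) hxs.not_ge
    filter_upwards [hI, lt_mem_nhds hHx] with h' hh' hlt
    by_contra hc
    push Not at hc
    have := hR.lt_apply h' hh' x ⟨by linarith, hx.trans (hR.lt h hh)⟩
    exact absurd this hlt.not_gt
  -- On the compact interval from x to R h₂ the minimum of H exceeds h. For h' below this minimum
  -- and below h₂, R h' cannot lie in that part of the interval beyond a.
  · intro a ha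
    obtain ⟨h₂, hh₂, hh₂M⟩ := exists_between hh.2
    have hI₂ : h₂ ∈ Ioo 0 M := ⟨hh.1.trans hh₂, hh₂M⟩
    have hlt₂ := hR.strictMonoOn hh hI₂ hh₂
    set x := min a (R h₂) with hx
    have hxR : R h < x := lt_min ha hlt₂
    have hcont : ContinuousOn H (Icc x (R h₂)) := fun y hy =>
      (hR.hasDerivAt_level (hy.2.trans_lt (hR.lt h₂ hI₂))).continuousAt.continuousWithinAt
    obtain ⟨y, hy, hmin⟩ := isCompact_Icc.exists_isMinOn (nonempty_Icc.2 (min_le_right _ _)) hcont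
    have hy1 : h < H y := hR.lt_apply h hh y
      ⟨hxR.trans_le hy.1, hy.2.trans_lt (hR.lt h₂ hI₂)⟩
    filter_upwards [hI, gt_mem_nhds hy1, gt_mem_nhds hh₂] with h' hh' hlt hlt2
    by_contra hc
    push Not at hc
    have h3 := hmin ⟨(min_le_left _ _).trans hc, (hR.strictMonoOn hh' hI₂ hlt2).le⟩
    rw [mem_ofPred_eq, hR.apply_eq h' hh'] at h3
    linarith

theorem hasDerivAt (hR : IsLastCrossing H q₀ M R) {h : ℝ} (hh : h ∈ Ioo 0 M) :
    HasDerivAt R (deriv H (R h))⁻¹ h := by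
  refine HasDerivAt.of_local_left_inverse (hR.continuousAt hh)
    (hR.hasDerivAt_level (hR.lt h hh)) (hR.deriv_pos h hh).ne' ?_
  filter_upwards [Ioo_mem_nhds hh.1 hh.2] with h' hh' using hR.apply_eq h' hh'

theorem contDiffAt_deriv (hR : IsLastCrossing H q₀ M R) {x : ℝ} (hx : x < q₀) :
    ContDiffAt ℝ 2 (deriv H) x :=
  ContDiffAt.derivWithin (hR.contDiffAt x hx) (by norm_num)

theorem hasDerivAt_comp (hR : IsLastCrossing H q₀ M R) {φ : ℝ → ℝ} {h : ℝ} (hh : h ∈ Ioo 0 M)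
    (hφ : ContDiffAt ℝ 1 φ (R h)) :
    HasDerivAt (fun h => φ (R h)) (deriv φ (R h) * (deriv H (R h))⁻¹) h :=
  ((hφ.differentiableAt (by norm_num)).hasDerivAt).comp h (hR.hasDerivAt hh)

theorem continuousAt_deriv_comp (hR : IsLastCrossing H q₀ M R) {φ : ℝ → ℝ} {h : ℝ}
    (hh : h ∈ Ioo 0 M) (hφ : ContDiffAt ℝ 1 φ (R h)) :
    ContinuousAt (fun h => deriv φ (R h) * (deriv H (R h))⁻¹) h := by
  have h1 : ContinuousAt (deriv φ) (R h) :=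
    (ContDiffAt.derivWithin (m := 0) hφ (by norm_num)).continuousAt
  have h2 : ContinuousAt (deriv H) (R h) := (hR.contDiffAt_deriv (hR.lt h hh)).continuousAt
  have h3 := hR.continuousAt hh
  exact (h1.comp h3).mul ((h2.comp h3).inv₀ (hR.deriv_pos h hh).ne')

end IsLastCrossing

/-! ### Abel integrals -/

theorem average_mem {m h₁ s : ℝ} (hm : m < h₁) (hs : s ∈ Icc (0 : ℝ) 1) :
    m + (h₁ - m) * s ^ 2 ∈ Icc m h₁ := by
  have h1 : s ^ 2 ≤ 1 := pow_le_one₀ hs.1 hs.2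
  constructor <;> nlinarith [sq_nonneg s]

theorem continuousOn_average {κ : ℝ → ℝ} {m h₁ : ℝ} (hm : m ∈ Ioo 0 h₁)
    (hc : ContinuousOn κ (Ioc 0 h₁)) :
    ContinuousOn (fun s => κ (m + (h₁ - m) * s ^ 2)) (Icc (0 : ℝ) 1) :=
  hc.comp (by fun_prop) fun s hs => by
    have := average_mem hm.2 hs
    exact ⟨hm.1.trans_le this.1, this.2⟩

theorem hasDerivAt_integral_average {κ κ' : ℝ → ℝ} {h₁ : ℝ}
    (hd : ∀ h ∈ Ioc 0 h₁, HasDerivAt κ (κ' h) h) (hc : ContinuousOn κ' (Ioc 0 h₁)) :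
    (∀ m ∈ Ioo 0 h₁, HasDerivAt (fun m => ∫ s in Ioo (0 : ℝ) 1, κ (m + (h₁ - m) * s ^ 2))
      (∫ s in Ioo (0 : ℝ) 1, κ' (m + (h₁ - m) * s ^ 2) * (1 - s ^ 2)) m) ∧
    ContinuousOn (fun m => ∫ s in Ioo (0 : ℝ) 1, κ' (m + (h₁ - m) * s ^ 2) * (1 - s ^ 2))
      (Ioo 0 h₁) := by
  have hκ : ContinuousOn κ (Ioc 0 h₁) := fun h hh => (hd h hh).continuousAt.continuousWithinAt
  have hmem : ∀ {m s : ℝ}, m ∈ Ioo 0 h₁ → s ∈ Ioo (0 : ℝ) 1 →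
      m + (h₁ - m) * s ^ 2 ∈ Ioc 0 h₁ := fun hm hs => by
    have := average_mem hm.2 (Ioo_subset_Icc_self hs)
    exact ⟨hm.1.trans_le this.1, this.2⟩
  refine hasDerivAt_integral_of_locally_bounded (F := fun m s => κ (m + (h₁ - m) * s ^ 2))
    (F' := fun m s => κ' (m + (h₁ - m) * s ^ 2) * (1 - s ^ 2)) isOpen_Ioo
    (fun m hm => ?_) (fun m hm => ?_) ?_ ?_ ?_
  · exact (((continuousOn_average hm hc).mul (by fun_prop)).mono
      Ioo_subset_Icc_self).aestronglyMeasurable measurableSet_Ioo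
  · exact (continuousOn_average hm hκ).integrableOn_Icc.mono_set Ioo_subset_Icc_self
  · filter_upwards [ae_restrict_mem measurableSet_Ioo] with s hs m hm
    have h1 : HasDerivAt (fun m => m + (h₁ - m) * s ^ 2) (1 - s ^ 2) m := by
      have := (hasDerivAt_id m).add (((hasDerivAt_id m).const_sub h₁).mul_const (s ^ 2))
      convert! this using 1
      ring
    exact (hd _ (hmem hm hs)).comp m h1
  · filter_upwards [ae_restrict_mem measurableSet_Ioo] with s hs
    exact (hc.comp (by fun_prop) fun m hm => hmem hm hs).mul continuousOn_const
  · intro m hm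
    obtain ⟨C, hC⟩ := isCompact_Icc.exists_bound_of_continuousOn
      (hc.mono fun h (hh : h ∈ Icc (m / 2) h₁) => ⟨by linarith [hh.1, hm.1], hh.2⟩)
    refine ⟨Ioo (m / 2) h₁, Ioo_mem_nhds (by linarith [hm.1]) hm.2, C, ?_⟩
    filter_upwards [ae_restrict_mem measurableSet_Ioo] with s hs m' hm'
    have h1 := average_mem hm'.2 (Ioo_subset_Icc_self hs)
    have h2 := hC _ ⟨hm'.1.le.trans h1.1, h1.2⟩
    have h3 : s ^ 2 ≤ 1 := pow_le_one₀ hs.1.le hs.2.le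
    rw [abs_mul, abs_of_nonneg (sub_nonneg.2 h3)]
    exact (mul_le_of_le_one_right (abs_nonneg _) (by linarith [sq_nonneg s])).trans h2

/-- The Abel-type integral `∫_m^{h₁} κ(h) / √(h - m) dh`, after the substitution
`h = m + (h₁ - m) s²`. -/
noncomputable def abelIntegral (κ : ℝ → ℝ) (h₁ m : ℝ) : ℝ :=
  2 * Real.sqrt (h₁ - m) * ∫ s in Ioo (0 : ℝ) 1, κ (m + (h₁ - m) * s ^ 2)

/-- `J'` is a continuous derivative of `J` on `(0, h₁)`. -/
def HasContDerivOn (J J' : ℝ → ℝ) (h₁ : ℝ) : Prop :=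
  (∀ m ∈ Ioo 0 h₁, HasDerivAt J (J' m) m) ∧ ContinuousOn J' (Ioo 0 h₁)

theorem HasContDerivOn.contDiffOn {J J' : ℝ → ℝ} {h₁ : ℝ} (h : HasContDerivOn J J' h₁) :
    ContDiffOn ℝ 1 J (Ioo 0 h₁) := by
  rw [show (1 : WithTop ℕ∞) = 0 + 1 by norm_num, contDiffOn_succ_iff_deriv_of_isOpen isOpen_Ioo]
  refine ⟨fun m hm => (h.1 m hm).differentiableAt.differentiableWithinAt, by simp, ?_⟩
  rw [contDiffOn_zero]
  exact h.2.congr fun m hm => (h.1 m hm).deriv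

theorem HasContDerivOn.add {J J' K K' : ℝ → ℝ} {h₁ : ℝ} (h : HasContDerivOn J J' h₁)
    (h' : HasContDerivOn K K' h₁) :
    HasContDerivOn (fun m => J m + K m) (fun m => J' m + K' m) h₁ :=
  ⟨fun m hm => (h.1 m hm).add (h'.1 m hm), h.2.add h'.2⟩

/-- After the substitution m enters only through κ at a regular argument and through √(h₁ − m),
which is smooth for m < h₁. Restricting to m < h₁/2 keeps 1/√(h₁ − m) bounded, so a bound on κ' down
to h = 0 gives one on the derivative down to m = 0. -/
theorem exists_hasContDerivOn_abelIntegral {κ κ' : ℝ → ℝ} {h₁ : ℝ}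
    (hd : ∀ h ∈ Ioc 0 h₁, HasDerivAt κ (κ' h) h) (hc : ContinuousOn κ' (Ioc 0 h₁)) :
    ∃ J', HasContDerivOn (abelIntegral κ h₁) J' h₁ ∧
      ∀ B, (∀ h ∈ Ioc 0 h₁, |κ' h| ≤ B) → ∃ B', ∀ m ∈ Ioo 0 (h₁ / 2), |J' m| ≤ B' := by
  obtain ⟨hA, hA'⟩ := hasDerivAt_integral_average hd hc
  set A := fun m => ∫ s in Ioo (0 : ℝ) 1, κ (m + (h₁ - m) * s ^ 2) with hAdef
  set A' := fun m => ∫ s in Ioo (0 : ℝ) 1, κ' (m + (h₁ - m) * s ^ 2) * (1 - s ^ 2) with hAdef'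
  have hAc : ContinuousOn A (Ioo 0 h₁) := fun m hm => (hA m hm).continuousAt.continuousWithinAt
  have hs0 : ∀ m ∈ Ioo 0 h₁, Real.sqrt (h₁ - m) ≠ 0 := fun m hm =>
    (Real.sqrt_pos.2 (sub_pos.2 hm.2)).ne'
  refine ⟨fun m => -(Real.sqrt (h₁ - m))⁻¹ * A m + 2 * Real.sqrt (h₁ - m) * A' m,
    ⟨fun m hm => ?_, ?_⟩, fun B hB => ?_⟩
  · have h1 := ((((hasDerivAt_id m).const_sub h₁).sqrt (sub_pos.2 hm.2).ne').const_mul 2).mul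
      (hA m hm)
    convert! h1 using 1
    have := hs0 m hm
    simp only [id]
    field_simp
    rfl
  · have hsc : ContinuousOn (fun m => Real.sqrt (h₁ - m)) (Ioo 0 h₁) := by fun_prop
    exact ((hsc.inv₀ hs0).neg.mul hAc).add ((hsc.const_smul (2 : ℝ)).mul hA')
  · have hκb : ∀ h ∈ Ioc 0 h₁, |κ h| ≤ |κ h₁| + B * h₁ := by
      intro h hh
      have h1 := Convex.norm_image_sub_le_of_norm_hasDerivWithin_le
        (fun x hx => (hd x hx).hasDerivWithinAt) hB (convex_Ioc 0 h₁)
        (right_mem_Ioc.2 (hh.1.trans_le hh.2)) hh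
      rw [Real.norm_eq_abs, Real.norm_eq_abs] at h1
      have hB0 : 0 ≤ B := (abs_nonneg _).trans (hB h hh)
      have h2 : B * |h - h₁| ≤ B * h₁ := by
        refine mul_le_mul_of_nonneg_left ?_ hB0
        rw [abs_of_nonpos (by linarith [hh.2])]
        linarith [hh.1]
      have := abs_sub_abs_le_abs_sub (κ h) (κ h₁)
      linarith
    set B₀ := |κ h₁| + B * h₁
    refine ⟨(Real.sqrt (h₁ / 2))⁻¹ * B₀ + 2 * Real.sqrt h₁ * B, fun m hm => ?_⟩
    have hm1 : m ∈ Ioo 0 h₁ := ⟨hm.1, by linarith [hm.1, hm.2]⟩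
    have hh₁ : 0 < h₁ := hm1.1.trans hm1.2
    have hmem : ∀ s ∈ Ioo (0 : ℝ) 1, m + (h₁ - m) * s ^ 2 ∈ Ioc 0 h₁ := fun s hs => by
      have := average_mem hm1.2 (Ioo_subset_Icc_self hs)
      exact ⟨hm1.1.trans_le this.1, this.2⟩
    have hA1 : |A m| ≤ B₀ := by
      have := norm_setIntegral_le_of_norm_le_const (μ := volume) (s := Ioo (0 : ℝ) 1)
        (f := fun s => κ (m + (h₁ - m) * s ^ 2)) (C := B₀) (by simp)
        (fun s hs => hκb _ (hmem s hs))
      simpa using this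
    have hA2 : |A' m| ≤ B := by
      have := norm_setIntegral_le_of_norm_le_const (μ := volume) (s := Ioo (0 : ℝ) 1)
        (f := fun s => κ' (m + (h₁ - m) * s ^ 2) * (1 - s ^ 2)) (C := B) (by simp)
        (fun s hs => by
          have h3 : s ^ 2 ≤ 1 := pow_le_one₀ hs.1.le hs.2.le
          rw [Real.norm_eq_abs, abs_mul, abs_of_nonneg (sub_nonneg.2 h3)]
          exact (mul_le_of_le_one_right (abs_nonneg _) (by linarith [sq_nonneg s])).trans
            (hB _ (hmem s hs)))
      simpa using this
    have e1 : Real.sqrt (h₁ / 2) ≤ Real.sqrt (h₁ - m) := Real.sqrt_le_sqrt (by linarith [hm.2])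
    have e2 : Real.sqrt (h₁ - m) ≤ Real.sqrt h₁ := Real.sqrt_le_sqrt (by linarith [hm.1])
    have e3 : 0 < Real.sqrt (h₁ / 2) := Real.sqrt_pos.2 (by linarith)
    refine (abs_add_le _ _).trans (add_le_add ?_ ?_)
    · rw [abs_mul, abs_neg, abs_inv, abs_of_nonneg (Real.sqrt_nonneg _)]
      gcongr
    · rw [abs_mul, abs_mul, abs_two, abs_of_nonneg (Real.sqrt_nonneg _)]
      gcongr

/-! ### The turning integral as a C¹ function of the squared speed -/

/-- The part of the momentum integral away from the turning point. -/
theorem exists_hasContDerivOn_tail {H : ℝ → ℝ} {q₀ b h₁ : ℝ} (hb : 0 < b) (hq : 0 < q₀)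
    (hH : ContinuousOn H (Ioo b q₀)) (hlt : ∀ x ∈ Ioo b q₀, h₁ < H x) :
    ∃ J', HasContDerivOn
        (fun m => ∫ x in Ioo b q₀, (q₀ - x) / (x * Real.sqrt (H x - m))) J' h₁ ∧
      ∃ B', ∀ m ∈ Ioo 0 (h₁ / 2), |J' m| ≤ B' := by
  have hpos : ∀ {m x : ℝ}, m < h₁ → x ∈ Ioo b q₀ → 0 < H x - m := fun hm hx => by
    linarith [hlt _ hx]
  have hbound : ∀ {δ m x : ℝ}, 0 < δ → m ≤ h₁ - δ → x ∈ Ioo b q₀ →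
      |(q₀ - x) / (x * (2 * ((H x - m) * Real.sqrt (H x - m))))|
        ≤ q₀ / (b * (2 * (δ * Real.sqrt δ))) := by
    intro δ m x hδ hm hx
    have h1 : δ ≤ H x - m := by linarith [hlt x hx]
    have h2 : 0 < x := hb.trans hx.1
    have h3 : 0 < q₀ - x := sub_pos.2 hx.2
    have h4 : 0 < H x - m := hδ.trans_le h1
    have h5 := hx.1.le
    rw [abs_of_nonneg (by positivity)]
    gcongr
    linarith
  have hcont : ∀ m < h₁, ContinuousOn (fun x => Real.sqrt (H x - m)) (Ioo b q₀) := fun m _ =>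
    (hH.sub continuousOn_const).sqrt
  have key := hasDerivAt_integral_of_locally_bounded (μ := volume.restrict (Ioo b q₀))
    (F := fun m x => (q₀ - x) / (x * Real.sqrt (H x - m)))
    (F' := fun m x => (q₀ - x) / (x * (2 * ((H x - m) * Real.sqrt (H x - m)))))
    (I := Ioo 0 h₁) isOpen_Ioo (fun m hm => ?_) (fun m hm => ?_) ?_ ?_ ?_
  -- For m < h₁/2 the gap H x − m exceeds h₁/2, so the bound does not degenerate as m tends to 0.
  · refine ⟨_, key, q₀ / (b * (2 * (h₁ / 2 * Real.sqrt (h₁ / 2)))) * volume.real (Ioo b q₀),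
      fun m hm => ?_⟩
    exact norm_setIntegral_le_of_norm_le_const (μ := volume)
      (f := fun x => (q₀ - x) / (x * (2 * ((H x - m) * Real.sqrt (H x - m))))) (by simp) fun x hx =>
      hbound (δ := h₁ / 2) (by linarith [hm.1, hm.2]) (by linarith [hm.2]) hx
  · refine ContinuousOn.aestronglyMeasurable ?_ measurableSet_Ioo
    refine ContinuousOn.div (by fun_prop) (continuousOn_id.mul (continuousOn_const.mul
      ((hH.sub continuousOn_const).mul (hcont m hm.2)))) fun x hx => ?_
    have h1 := hpos hm.2 hx
    have h2 : 0 < x := hb.trans hx.1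
    positivity
  · have hm' := hm.2
    refine Integrable.of_bound ?_ (q₀ / (b * Real.sqrt (h₁ - m))) ?_
    · refine ContinuousOn.aestronglyMeasurable ?_ measurableSet_Ioo
      refine ContinuousOn.div (by fun_prop) (continuousOn_id.mul (hcont m hm.2)) fun x hx => ?_
      have h1 := hpos hm.2 hx
      have h2 : 0 < x := hb.trans hx.1
      positivity
    · filter_upwards [ae_restrict_mem measurableSet_Ioo] with x hx
      have h1 := hpos hm.2 hx
      have h2 : 0 < x := hb.trans hx.1
      have h3 : 0 < q₀ - x := sub_pos.2 hx.2
      have h4 : h₁ - m ≤ H x - m := by linarith [hlt x hx]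
      have h5 := hx.1.le
      have h6 : 0 < h₁ - m := sub_pos.2 hm'
      rw [Real.norm_of_nonneg (by positivity)]
      gcongr
      linarith
  · filter_upwards [ae_restrict_mem measurableSet_Ioo] with x hx m hm
    have h1 := hpos hm.2 hx
    have h2 : 0 < x := hb.trans hx.1
    have h3 : 0 < Real.sqrt (H x - m) := Real.sqrt_pos.2 h1
    have h4 := (hasDerivAt_const m (q₀ - x)).div
      ((((hasDerivAt_id m).const_sub (H x)).sqrt h1.ne').const_mul x) (by simp only [id]; positivity)
    convert! h4 using 1
    simp only [id]
    have h5 : Real.sqrt (H x - m) ^ 2 = H x - m := Real.sq_sqrt h1.le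
    generalize Real.sqrt (H x - m) = r at *
    rw [← h5]
    field_simp
    ring
  · filter_upwards [ae_restrict_mem measurableSet_Ioo] with x hx
    refine ContinuousOn.div continuousOn_const (by fun_prop) fun m hm => ?_
    have h1 := hpos hm.2 hx
    have h2 : 0 < x := hb.trans hx.1
    positivity
  · intro m hm
    refine ⟨Iic (h₁ - (h₁ - m) / 2), Iic_mem_nhds (by linarith [hm.2]),
      q₀ / (b * (2 * ((h₁ - m) / 2 * Real.sqrt ((h₁ - m) / 2)))), ?_⟩
    filter_upwards [ae_restrict_mem measurableSet_Ioo] with x hx m' hm'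
    exact hbound (by linarith [hm.2]) hm' hx

/-- The integral giving the momentum of the profile with turning point `R m`. -/
noncomputable def turningIntegral (H R : ℝ → ℝ) (q₀ m : ℝ) : ℝ :=
  ∫ x in Ioo (R m) q₀, (q₀ - x) / (x * Real.sqrt (H x - m))

theorem HasContDerivOn.congr {J K J' : ℝ → ℝ} {h₁ : ℝ} (h : HasContDerivOn J J' h₁)
    (heq : ∀ m ∈ Ioo 0 h₁, K m = J m) : HasContDerivOn K J' h₁ :=
  ⟨fun m hm => (h.1 m hm).congr_of_eventuallyEq (by
    filter_upwards [Ioo_mem_nhds hm.1 hm.2] with m' hm' using heq m' hm'), h.2⟩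

namespace IsLastCrossing

variable {H R : ℝ → ℝ} {q₀ M : ℝ}

theorem image_average (hR : IsLastCrossing H q₀ M R) {m h₁ : ℝ} (hm : 0 < m) (hmh : m < h₁)
    (hM : h₁ < M) :
    (fun s => R (m + (h₁ - m) * s ^ 2)) '' Ioo (0 : ℝ) 1 = Ioo (R m) (R h₁) := by
  have hI : ∀ s ∈ Icc (0 : ℝ) 1, m + (h₁ - m) * s ^ 2 ∈ Ioo 0 M := fun s hs => by
    have := average_mem hmh hs
    exact ⟨hm.trans_le this.1, this.2.trans_lt hM⟩
  apply Subset.antisymm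
  · rintro _ ⟨s, hs, rfl⟩
    have h1 : 0 < (h₁ - m) * s ^ 2 := mul_pos (sub_pos.2 hmh) (pow_pos hs.1 2)
    have h2 : (h₁ - m) * s ^ 2 < (h₁ - m) * 1 :=
      mul_lt_mul_of_pos_left (pow_lt_one₀ hs.1.le hs.2 two_ne_zero) (sub_pos.2 hmh)
    exact ⟨hR.strictMonoOn ⟨hm, hmh.trans hM⟩ (hI s (Ioo_subset_Icc_self hs)) (by linarith),
      hR.strictMonoOn (hI s (Ioo_subset_Icc_self hs)) ⟨hm.trans hmh, hM⟩ (by linarith)⟩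
  · have hc : ContinuousOn (fun s => R (m + (h₁ - m) * s ^ 2)) (Icc (0 : ℝ) 1) := fun s hs =>
      (ContinuousAt.comp (f := fun s : ℝ => m + (h₁ - m) * s ^ 2) (hR.continuousAt (hI s hs))
        (by fun_prop)).continuousWithinAt
    simpa using intermediate_value_Ioo zero_le_one hc

/-- With x = R(m + (h₁ − m)s²) the root becomes √(h₁ − m)·s, and its s cancels the s in the
Jacobian. -/
theorem integral_near (hR : IsLastCrossing H q₀ M R) {m h₁ : ℝ} (hm : 0 < m) (hmh : m < h₁)
    (hM : h₁ < M) :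
    ∫ x in Ioo (R m) (R h₁), (q₀ - x) / (x * Real.sqrt (H x - m))
      = abelIntegral (fun h => (q₀ - R h) / (R h * deriv H (R h))) h₁ m := by
  have hI : ∀ s ∈ Ioo (0 : ℝ) 1, m + (h₁ - m) * s ^ 2 ∈ Ioo 0 M := fun s hs => by
    have := average_mem hmh (Ioo_subset_Icc_self hs)
    exact ⟨hm.trans_le this.1, this.2.trans_lt hM⟩
  have hd : ∀ s ∈ Ioo (0 : ℝ) 1, HasDerivWithinAt (fun s => R (m + (h₁ - m) * s ^ 2))
      ((deriv H (R (m + (h₁ - m) * s ^ 2)))⁻¹ * ((h₁ - m) * (2 * s))) (Ioo 0 1) s := by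
    intro s hs
    have h1 : HasDerivAt (fun s : ℝ => m + (h₁ - m) * s ^ 2) ((h₁ - m) * (2 * s)) s := by
      have := ((((hasDerivAt_id s).pow 2).const_mul (h₁ - m)).const_add m)
      convert! this using 1
      simp
    exact ((hR.hasDerivAt (hI s hs)).comp s h1).hasDerivWithinAt
  have hmono : MonotoneOn (fun s => R (m + (h₁ - m) * s ^ 2)) (Ioo (0 : ℝ) 1) := by
    intro s hs t ht hst
    refine hR.strictMonoOn.monotoneOn (hI s hs) (hI t ht) ?_
    have := mul_le_mul_of_nonneg_left (pow_le_pow_left₀ hs.1.le hst 2) (sub_pos.2 hmh).le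
    linarith
  rw [← hR.image_average hm hmh hM,
    integral_image_eq_integral_deriv_smul_of_monotoneOn measurableSet_Ioo hd hmono, abelIntegral,
    ← integral_const_mul]
  refine setIntegral_congr_fun measurableSet_Ioo fun s hs => ?_
  have h1 := hR.deriv_pos _ (hI s hs)
  have h2 := hR.pos _ (hI s hs)
  have h3 : Real.sqrt (H (R (m + (h₁ - m) * s ^ 2)) - m) = Real.sqrt (h₁ - m) * s := by
    rw [hR.apply_eq _ (hI s hs), add_sub_cancel_left, Real.sqrt_mul (sub_pos.2 hmh).le,
      Real.sqrt_sq hs.1.le]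
  have h4 : Real.sqrt (h₁ - m) ^ 2 = h₁ - m := Real.sq_sqrt (sub_pos.2 hmh).le
  have h5 : 0 < Real.sqrt (h₁ - m) := Real.sqrt_pos.2 (sub_pos.2 hmh)
  have h6 := hs.1
  simp only [smul_eq_mul]
  rw [h3]
  field_simp
  rw [h4]
  ring

/-- Cutting at the fixed point R h₁ confines both the moving endpoint and the inverse square root
singularity to the Abel integral. -/
theorem turningIntegral_eq (hR : IsLastCrossing H q₀ M R)
    (hint : ∀ h ∈ Ioo 0 M,
      IntegrableOn (fun x => (q₀ - x) / (x * Real.sqrt (H x - h))) (Ioo (R h) q₀))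
    {m h₁ : ℝ} (hm : m ∈ Ioo 0 h₁) (hM : h₁ < M) :
    turningIntegral H R q₀ m
      = abelIntegral (fun h => (q₀ - R h) / (R h * deriv H (R h))) h₁ m
        + ∫ x in Ioo (R h₁) q₀, (q₀ - x) / (x * Real.sqrt (H x - m)) := by
  have hmI : m ∈ Ioo 0 M := ⟨hm.1, hm.2.trans hM⟩
  have hhI : h₁ ∈ Ioo 0 M := ⟨hm.1.trans hm.2, hM⟩
  have hlt := hR.strictMonoOn hmI hhI hm.2
  have hi := hint m hmI
  have hu := Ioo_union_Ico_eq_Ioo hlt (hR.lt h₁ hhI).le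
  rw [← hu, integrableOn_union] at hi
  rw [← hR.integral_near hm.1 hm.2 hM, turningIntegral, ← hu,
    setIntegral_union (by
      rw [Set.disjoint_left]
      exact fun x hx hx' => hx.2.not_ge hx'.1) measurableSet_Ico hi.1 hi.2,
    integral_Ico_eq_integral_Ioo]

theorem exists_hasContDerivOn_tail (hR : IsLastCrossing H q₀ M R) {h₁ : ℝ} (hh₁ : h₁ ∈ Ioo 0 M) :
    ∃ J', HasContDerivOn
        (fun m => ∫ x in Ioo (R h₁) q₀, (q₀ - x) / (x * Real.sqrt (H x - m))) J' h₁ ∧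
      ∃ B', ∀ m ∈ Ioo 0 (h₁ / 2), |J' m| ≤ B' :=
  _root_.exists_hasContDerivOn_tail (hR.pos h₁ hh₁) ((hR.pos h₁ hh₁).trans (hR.lt h₁ hh₁))
    (fun _ hx => (hR.hasDerivAt_level hx.2).continuousAt.continuousWithinAt)
    (hR.lt_apply h₁ hh₁)

theorem exists_hasContDerivOn (hR : IsLastCrossing H q₀ M R)
    (hint : ∀ h ∈ Ioo 0 M,
      IntegrableOn (fun x => (q₀ - x) / (x * Real.sqrt (H x - h))) (Ioo (R h) q₀))
    {h₁ : ℝ} (hh₁ : h₁ ∈ Ioo 0 M) :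
    ∃ J', HasContDerivOn (turningIntegral H R q₀) J' h₁ := by
  obtain ⟨T', hT', -⟩ := hR.exists_hasContDerivOn_tail hh₁
  have hφ : ∀ h ∈ Ioo 0 M, ContDiffAt ℝ 1 (fun x => (q₀ - x) / (x * deriv H x)) (R h) := by
    intro h hh
    have h1 : ContDiffAt ℝ 1 (deriv H) (R h) :=
      (hR.contDiffAt_deriv (hR.lt h hh)).of_le (by norm_num)
    exact ContDiffAt.div (by fun_prop) (by fun_prop)
      (mul_pos (hR.pos h hh) (hR.deriv_pos h hh)).ne'
  have hsub : Ioc 0 h₁ ⊆ Ioo 0 M := fun h hh => ⟨hh.1, hh.2.trans_lt hh₁.2⟩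
  obtain ⟨A', hA', -⟩ := exists_hasContDerivOn_abelIntegral
    (fun h hh => hR.hasDerivAt_comp (hsub hh) (hφ h (hsub hh)))
    (fun h hh => (hR.continuousAt_deriv_comp (hsub hh) (hφ h (hsub hh))).continuousWithinAt)
  exact ⟨_, (hA'.add hT').congr fun m hm => hR.turningIntegral_eq hint hm hh₁.2⟩

end IsLastCrossing

/-! ### The limit of zero speed -/

/-- This is the singular contribution of a vacuum point. With m = v² its 1/√m is compensated by the
factor v in the momentum. -/
theorem integral_inv_average {m h₁ : ℝ} (l : ℝ) (hm : m ∈ Ioo 0 h₁) :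
    abelIntegral (fun h => l / h) h₁ m
      = 2 * l / Real.sqrt m * Real.arctan (Real.sqrt (h₁ - m) / Real.sqrt m) := by
  have h1 : 0 < Real.sqrt m := Real.sqrt_pos.2 hm.1
  have h2 : 0 < Real.sqrt (h₁ - m) := Real.sqrt_pos.2 (sub_pos.2 hm.2)
  have e1 : Real.sqrt m ^ 2 = m := Real.sq_sqrt hm.1.le
  have e2 : Real.sqrt (h₁ - m) ^ 2 = h₁ - m := Real.sq_sqrt (sub_pos.2 hm.2).le
  have hpos : ∀ s : ℝ, 0 < m + (h₁ - m) * s ^ 2 := fun s => by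
    have := sub_pos.2 hm.2
    have := hm.1
    positivity
  have hd : ∀ s : ℝ, HasDerivAt
      (fun s => l / (Real.sqrt m * Real.sqrt (h₁ - m))
        * Real.arctan (Real.sqrt (h₁ - m) / Real.sqrt m * s)) (l / (m + (h₁ - m) * s ^ 2)) s := by
    intro s
    have := (((hasDerivAt_id s).const_mul (Real.sqrt (h₁ - m) / Real.sqrt m)).arctan).const_mul
      (l / (Real.sqrt m * Real.sqrt (h₁ - m)))
    convert! this using 1
    have h3 : m + (h₁ - m) * s ^ 2 = Real.sqrt m ^ 2 + (Real.sqrt (h₁ - m) * s) ^ 2 := by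
      rw [mul_pow, e1, e2]
    rw [h3]
    simp only [id]
    have h4 : 1 + (Real.sqrt (h₁ - m) / Real.sqrt m * s) ^ 2 ≠ 0 := by positivity
    have h5 : Real.sqrt m ^ 2 + (Real.sqrt (h₁ - m) * s) ^ 2 ≠ 0 := by positivity
    field_simp
  have hI := intervalIntegral.integral_eq_sub_of_hasDerivAt (a := 0) (b := 1) (fun s _ => hd s)
    ((continuous_const.div (by fun_prop) fun s => (hpos s).ne').intervalIntegrable _ _)
  rw [intervalIntegral.integral_of_le zero_le_one, integral_Ioc_eq_integral_Ioo] at hI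
  simp only [mul_one, mul_zero, Real.arctan_zero, sub_zero] at hI
  rw [abelIntegral, hI]
  field_simp

theorem abelIntegral_add {κ : ℝ → ℝ} {m h₁ : ℝ} (l : ℝ) (hm : m ∈ Ioo 0 h₁)
    (hκ : ContinuousOn κ (Ioc 0 h₁)) :
    abelIntegral (fun h => l / h + κ h) h₁ m
      = abelIntegral (fun h => l / h) h₁ m + abelIntegral κ h₁ m := by
  have h1 : ContinuousOn (fun h : ℝ => l / h) (Ioc 0 h₁) :=
    continuousOn_const.div continuousOn_id fun h hh => hh.1.ne'
  have i1 := (continuousOn_average hm h1).integrableOn_Icc.mono_set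
    (μ := volume) Ioo_subset_Icc_self
  have i2 := (continuousOn_average hm hκ).integrableOn_Icc.mono_set
    (μ := volume) Ioo_subset_Icc_self
  rw [abelIntegral, integral_add i1 i2, mul_add]
  rfl

theorem abelIntegral_congr {κ κ₁ : ℝ → ℝ} {m h₁ : ℝ} (hm : m ∈ Ioo 0 h₁)
    (h : EqOn κ κ₁ (Ioc 0 h₁)) : abelIntegral κ h₁ m = abelIntegral κ₁ h₁ m := by
  rw [abelIntegral, abelIntegral, setIntegral_congr_fun measurableSet_Ioo fun s hs => h ?_]
  have := average_mem hm.2 (Ioo_subset_Icc_self hs)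
  exact ⟨hm.1.trans_le this.1, this.2⟩

/-- A function on `(0, b)` with bounded derivative has a limit at `0`. -/
theorem exists_tendsto_of_bounded_deriv {J J' : ℝ → ℝ} {b B : ℝ} (hb : 0 < b)
    (hJ : ∀ m ∈ Ioo 0 b, HasDerivAt J (J' m) m) (hB : ∀ m ∈ Ioo 0 b, |J' m| ≤ B) :
    ∃ L, Tendsto J (𝓝[>] 0) (𝓝 L) := by
  have hB0 : 0 ≤ B := (abs_nonneg _).trans (hB (b / 2) ⟨by linarith, by linarith⟩)
  -- A bounded derivative makes J Lipschitz, and the value at 0 of a Lipschitz extension is the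
  -- limit.
  have hL : LipschitzOnWith (Real.toNNReal B) J (Ioo 0 b) :=
    (convex_Ioo 0 b).lipschitzOnWith_of_nnnorm_hasDerivWithin_le
      (fun m hm => (hJ m hm).hasDerivWithinAt) fun m hm => by
        rw [← NNReal.coe_le_coe, Real.coe_toNNReal _ hB0]
        exact hB m hm
  obtain ⟨g, hg, hgJ⟩ := hL.extend_real
  refine ⟨g 0, ((hg.continuous.tendsto 0).mono_left nhdsWithin_le_nhds).congr' ?_⟩
  filter_upwards [Ioo_mem_nhdsGT hb] with m hm using (hgJ hm).symm

/-- The derivative of `v ↦ 2 l arctan (√(h₁ - v²) / v) + v J(v²)` has a limit at `0⁺`. -/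
theorem exists_tendsto_deriv_arctan_add {J J' P : ℝ → ℝ} {h₁ B l : ℝ} (hh₁ : 0 < h₁)
    (hJ : ∀ m ∈ Ioo 0 (h₁ / 2), HasDerivAt J (J' m) m) (hB : ∀ m ∈ Ioo 0 (h₁ / 2), |J' m| ≤ B)
    (hP : ∀ v, 0 < v → v ^ 2 < h₁ / 2 →
      P v = 2 * l * Real.arctan (Real.sqrt (h₁ - v ^ 2) / v) + v * J (v ^ 2)) :
    ∃ L, Tendsto (deriv P) (𝓝[>] 0) (𝓝 L) := by
  obtain ⟨L, hL⟩ := exists_tendsto_of_bounded_deriv (by linarith) hJ hB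
  have hsmall : ∀ᶠ v : ℝ in 𝓝 0, v ^ 2 < h₁ / 2 :=
    (continuous_pow 2).continuousAt.eventually_lt continuousAt_const (by simpa using hh₁)
  have hd : ∀ v, 0 < v → v ^ 2 < h₁ / 2 →
      deriv P v = -(2 * l) / Real.sqrt (h₁ - v ^ 2) + (J (v ^ 2) + 2 * (v ^ 2 * J' (v ^ 2))) := by
    intro v hv hv2
    have hpos : 0 < h₁ - v ^ 2 := by linarith
    have hs : 0 < Real.sqrt (h₁ - v ^ 2) := Real.sqrt_pos.2 hpos
    have es : Real.sqrt (h₁ - v ^ 2) ^ 2 = h₁ - v ^ 2 := Real.sq_sqrt hpos.le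
    have hsq : HasDerivAt (fun v : ℝ => v ^ 2) (2 * v) v := by simpa using hasDerivAt_pow 2 v
    have h1 := (((hsq.const_sub h₁).sqrt hpos.ne').div (hasDerivAt_id v) hv.ne').arctan.const_mul
      (2 * l)
    have h2 := (hasDerivAt_id v).mul (HasDerivAt.comp (h := fun v : ℝ => v ^ 2) v
      (hJ (v ^ 2) ⟨by positivity, hv2⟩) hsq)
    have h3 : HasDerivAt P _ v := (h1.add h2).congr_of_eventuallyEq (by
      filter_upwards [lt_mem_nhds hv, (continuous_pow 2).continuousAt.eventually_lt
        continuousAt_const hv2] with w hw hw2 using hP w hw hw2)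
    rw [h3.deriv]
    simp only [id, Pi.div_apply, Function.comp_apply]
    -- This identity cancels the v² of the quotient rule, so the arctangent term has derivative
    -- −2l/√(h₁ − v²), which is regular at 0.
    have e : 1 + (Real.sqrt (h₁ - v ^ 2) / v) ^ 2 = h₁ / v ^ 2 := by
      rw [div_pow, es]
      field_simp
      ring
    rw [e]
    have e' : -(2 * v) / (2 * Real.sqrt (h₁ - v ^ 2)) * v - Real.sqrt (h₁ - v ^ 2) * 1
        = - h₁ / Real.sqrt (h₁ - v ^ 2) := by
      field_simp
      rw [es]
      ring
    rw [e']
    field_simp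
  have t0 : Tendsto (fun v : ℝ => v ^ 2) (𝓝[>] 0) (𝓝[>] 0) := by
    refine tendsto_nhdsWithin_iff.2 ⟨?_, ?_⟩
    · have : Tendsto (fun v : ℝ => v ^ 2) (𝓝 0) (𝓝 0) := by
        simpa using (continuous_pow 2).tendsto (0 : ℝ)
      exact this.mono_left nhdsWithin_le_nhds
    · filter_upwards [self_mem_nhdsWithin] with v hv using pow_pos (mem_Ioi.1 hv) 2
  have t0' := tendsto_nhds_of_tendsto_nhdsWithin t0
  have t1 : Tendsto (fun v : ℝ => -(2 * l) / Real.sqrt (h₁ - v ^ 2)) (𝓝[>] 0)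
      (𝓝 (-(2 * l) / Real.sqrt (h₁ - 0))) := by
    refine tendsto_const_nhds.div ((Real.continuous_sqrt.tendsto _).comp (t0'.const_sub h₁)) ?_
    rw [sub_zero]
    exact (Real.sqrt_pos.2 hh₁).ne'
  have t2 : Tendsto (fun v : ℝ => v ^ 2 * J' (v ^ 2)) (𝓝[>] 0) (𝓝 0) := by
    have : Tendsto (fun v : ℝ => v ^ 2 * B) (𝓝[>] 0) (𝓝 0) := by simpa using t0'.mul_const B
    refine squeeze_zero_norm' ?_ this
    filter_upwards [self_mem_nhdsWithin, nhdsWithin_le_nhds hsmall] with v hv hv2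
    rw [norm_mul, Real.norm_of_nonneg (sq_nonneg v)]
    exact mul_le_mul_of_nonneg_left (hB _ ⟨pow_pos (mem_Ioi.1 hv) 2, hv2⟩) (sq_nonneg v)
  refine ⟨_, (t1.add ((hL.comp t0).add (t2.const_mul 2))).congr' ?_⟩
  filter_upwards [self_mem_nhdsWithin, nhdsWithin_le_nhds hsmall] with v hv hv2
  exact (hd v hv hv2).symm

/-- Since H'(a₀) ≠ 0, the derivative of φ ∘ R stays bounded as h tends to 0⁺, so φ ∘ R gives an Abel
integral with bounded derivative. Only l/h is singular, and it is integrated explicitly. -/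
theorem IsLastCrossing.exists_tendsto_deriv {H R : ℝ → ℝ} {q₀ M a₀ l : ℝ} {φ : ℝ → ℝ}
    (hR : IsLastCrossing H q₀ M R) (hM : 0 < M)
    (hint : ∀ h ∈ Ioo 0 M,
      IntegrableOn (fun x => (q₀ - x) / (x * Real.sqrt (H x - h))) (Ioo (R h) q₀))
    (ha : Tendsto R (𝓝[>] 0) (𝓝 a₀)) (haq : a₀ < q₀) (hH : deriv H a₀ ≠ 0)
    (hφ : ContDiffAt ℝ 1 φ a₀)
    (heq : ∀ᶠ h in 𝓝[>] 0, (q₀ - R h) / (R h * deriv H (R h)) = l / h + φ (R h)) :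
    ∃ L, Tendsto (deriv fun v => v * turningIntegral H R q₀ (v ^ 2)) (𝓝[>] 0) (𝓝 L) := by
  have hκ' : Tendsto (fun h => deriv φ (R h) * (deriv H (R h))⁻¹) (𝓝[>] 0)
      (𝓝 (deriv φ a₀ * (deriv H a₀)⁻¹)) := by
    have h1 : ContinuousAt (deriv φ) a₀ :=
      (ContDiffAt.derivWithin (m := 0) hφ (by norm_num)).continuousAt
    have h2 : ContinuousAt (deriv H) a₀ := (hR.contDiffAt_deriv haq).continuousAt
    exact (h1.tendsto.comp ha).mul ((h2.tendsto.comp ha).inv₀ hH)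
  set B := |deriv φ a₀ * (deriv H a₀)⁻¹| + 1
  have hbd : ∀ᶠ h in 𝓝[>] 0, |deriv φ (R h) * (deriv H (R h))⁻¹| ≤ B :=
    (hκ'.abs.eventually_lt_const (lt_add_one _)).mono fun _ h => h.le
  have hcd : ∀ᶠ h in 𝓝[>] 0, ContDiffAt ℝ 1 φ (R h) := ha.eventually (hφ.eventually (by simp))
  obtain ⟨h₁, hh₁, hall⟩ : ∃ h₁ ∈ Ioo 0 M, ∀ h ∈ Ioc 0 h₁,
      |deriv φ (R h) * (deriv H (R h))⁻¹| ≤ B ∧ ContDiffAt ℝ 1 φ (R h) ∧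
      (q₀ - R h) / (R h * deriv H (R h)) = l / h + φ (R h) := by
    obtain ⟨u, hu, hsub⟩ := mem_nhdsGT_iff_exists_Ioo_subset.1 (hbd.and (hcd.and heq))
    have hu0 : (0 : ℝ) < u := hu
    refine ⟨min u M / 2, ⟨by positivity, by linarith [min_le_right u M]⟩, fun h hh => hsub ⟨hh.1, ?_⟩⟩
    linarith [hh.2, min_le_left u M]
  have hsub : Ioc 0 h₁ ⊆ Ioo 0 M := fun h hh => ⟨hh.1, hh.2.trans_lt hh₁.2⟩
  obtain ⟨A', hA', hAb⟩ := exists_hasContDerivOn_abelIntegral (h₁ := h₁)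
    (fun h hh => hR.hasDerivAt_comp (hsub hh) (hall h hh).2.1)
    (fun h hh => (hR.continuousAt_deriv_comp (hsub hh) (hall h hh).2.1).continuousWithinAt)
  obtain ⟨B₁, hB₁⟩ := hAb B fun h hh => (hall h hh).1
  obtain ⟨T', hT', B₂, hB₂⟩ := hR.exists_hasContDerivOn_tail hh₁
  have hJ := hA'.add hT'
  refine exists_tendsto_deriv_arctan_add (l := l) (B := B₁ + B₂) hh₁.1
    (fun m hm => hJ.1 m ⟨hm.1, by linarith [hm.1, hm.2]⟩)
    (fun m hm => (abs_add_le _ _).trans (add_le_add (hB₁ m hm) (hB₂ m hm)))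
    fun v hv hv2 => ?_
  have hm : v ^ 2 ∈ Ioo 0 h₁ := ⟨by positivity, by linarith [hh₁.1]⟩
  rw [hR.turningIntegral_eq hint hm hh₁.2, abelIntegral_congr hm fun h hh => (hall h hh).2.2,
    abelIntegral_add (κ := fun h => φ (R h)) l hm
      (fun h hh => (hR.hasDerivAt_comp (hsub hh) (hall h hh).2.1).continuousAt.continuousWithinAt),
    integral_inv_average l hm, Real.sqrt_sq hv.le]
  field_simp
  ring

/-! ### Nondegeneracy and regular part at the limiting turning point -/

theorem ContDiff.exists_le_mul_sq {Q : ℝ → ℝ} (hQ : ContDiff ℝ 2 Q) {a b q : ℝ}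
    (ha : a ∈ Icc b q) (h0 : Q a = 0) (h1 : deriv Q a = 0) :
    ∃ K, 0 ≤ K ∧ ∀ x ∈ Icc b q, Q x ≤ K * (x - a) ^ 2 := by
  have hQ' : ContDiff ℝ 1 (deriv Q) := by
    rw [show (2 : WithTop ℕ∞) = 1 + 1 by norm_num, contDiff_succ_iff_deriv] at hQ
    exact hQ.2.2
  obtain ⟨K, hK⟩ := (hQ'.locallyLipschitz.locallyLipschitzOn
    (s := Icc b q)).exists_lipschitzOnWith_of_compact isCompact_Icc
  refine ⟨K, K.2, fun x hx => ?_⟩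
  have hseg : uIcc a x ⊆ Icc b q := uIcc_subset_Icc ha hx
  have hb : ∀ y ∈ uIcc a x, ‖deriv Q y‖ ≤ K * |x - a| := by
    intro y hy
    have h2 := hK.dist_le_mul y (hseg hy) a ha
    rw [h1, dist_zero_right, Real.dist_eq] at h2
    refine h2.trans (mul_le_mul_of_nonneg_left ?_ K.2)
    exact abs_sub_left_of_mem_uIcc hy
  have h3 := Convex.norm_image_sub_le_of_norm_hasDerivWithin_le
    (fun y _ => ((hQ.differentiable (by norm_num) y).hasDerivAt).hasDerivWithinAt) hb
    (convex_uIcc a x) left_mem_uIcc right_mem_uIcc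
  rw [h0, sub_zero, Real.norm_eq_abs, Real.norm_eq_abs, mul_assoc, abs_mul_abs_self, ← sq] at h3
  exact (le_abs_self _).trans h3

/-- Gronwall: dropping the term −4m(q₀ − ρ)² ≤ 0 leaves ρ'² ≤ K(ρ − a)². The rate √K does not
involve m, so the estimate survives the limit of zero speed. -/
theorem IsDensityProfile.sub_le_exp {f : ℝ → ℝ} {q₀ m a K : ℝ} {ρ ρ' : ℝ → ℝ}
    (hf : ContDiff ℝ 2 f) (h : IsDensityProfile f q₀ m ρ ρ') (hm : 0 ≤ m) (hK : 0 ≤ K)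
    (hQ : ∀ x ∈ Icc 0 q₀, 8 * x * bgPotential f q₀ x ≤ K * (x - a) ^ 2) (ha : a ≤ ρ 0)
    {z : ℝ} (hz : 0 ≤ z) : ρ z - a ≤ (ρ 0 - a) * Real.exp (Real.sqrt K * z) := by
  have hd : ∀ x, HasDerivAt (fun x => (ρ x - a) * Real.exp (-(Real.sqrt K * x)))
      ((ρ' x - Real.sqrt K * (ρ x - a)) * Real.exp (-(Real.sqrt K * x))) x := by
    intro x
    have := ((h.hasDerivAt x).sub_const a).mul
      (((hasDerivAt_id x).const_mul (Real.sqrt K)).neg.exp)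
    convert! this using 1
    simp only [id, Pi.neg_apply]
    ring
  have hle : ∀ x, 0 ≤ x → ρ' x ≤ Real.sqrt K * (ρ x - a) := by
    intro x hx
    have h1 : 0 ≤ ρ x - a := by linarith [h.apply_zero_le hf hx]
    refine abs_le_of_sq_le_sq' ?_ (by positivity) |>.2
    rw [h.sq_eq, mul_pow, Real.sq_sqrt hK]
    have := hQ _ (h.mem_Icc x)
    have : 0 ≤ 4 * m * (q₀ - ρ x) ^ 2 := by positivity
    linarith
  have hanti : AntitoneOn (fun x => (ρ x - a) * Real.exp (-(Real.sqrt K * x))) (Ici 0) :=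
    antitoneOn_of_hasDerivWithinAt_nonpos (convex_Ici 0)
      (fun x _ => (hd x).continuousAt.continuousWithinAt)
      (fun x _ => (hd x).hasDerivWithinAt) fun x hx => by
        have := hle x (interior_subset hx)
        exact mul_nonpos_of_nonpos_of_nonneg (by linarith) (Real.exp_pos _).le
  have := hanti (mem_Ici.2 le_rfl) hz hz
  simp only [mul_zero, neg_zero, Real.exp_zero, mul_one] at this
  calc ρ z - a = (ρ z - a) * Real.exp (-(Real.sqrt K * z)) * Real.exp (Real.sqrt K * z) := by
        rw [mul_assoc, ← Real.exp_add, neg_add_cancel, Real.exp_zero, mul_one]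
    _ ≤ _ := by gcongr

/-- The regular part of the inverse Jacobian weight at a turning point, in both the case of a
positive limiting density and the case of a vacuum point. -/
theorem exists_regular_part {f : ℝ → ℝ} (hf : ContDiff ℝ 2 f) {q₀ M a₀ : ℝ} {R : ℝ → ℝ}
    (hR : IsLastCrossing (speedSq f q₀) q₀ M R) (hM : 0 < M) (ha0 : 0 ≤ a₀) (haq : a₀ < q₀)
    (hH : deriv (speedSq f q₀) a₀ ≠ 0) :
    ∃ (l : ℝ) (φ : ℝ → ℝ), ContDiffAt ℝ 1 φ a₀ ∧ ∀ᶠ h in 𝓝[>] 0,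
      (q₀ - R h) / (R h * deriv (speedSq f q₀) (R h)) = l / h + φ (R h) := by
  rcases ha0.lt_or_eq with hpos | rfl
  · refine ⟨0, fun x => (q₀ - x) / (x * deriv (speedSq f q₀) x), ?_, by simp⟩
    have h1 : ContDiffAt ℝ 1 (deriv (speedSq f q₀)) a₀ :=
      (contDiffAt_deriv_speedSq hf haq).of_le (by norm_num)
    exact ContDiffAt.div (by fun_prop) (by fun_prop) (mul_ne_zero hpos.ne' hH)
  -- Vacuum case: H = 2xG vanishes at 0 and H'(0) = 2G(0), so nondegeneracy means G(0) ≠ 0.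
  · set G : ℝ → ℝ := fun x => bgPotential f q₀ x / (q₀ - x) ^ 2 with hG
    have hGc : ∀ x < q₀, ContDiffAt ℝ 2 G x := by
      intro x hx
      have hF : ContDiffAt ℝ 2 (bgPotential f q₀) x :=
        ((contDiff_bgPotential hf q₀).of_le (by norm_num)).contDiffAt
      exact ContDiffAt.div hF (by fun_prop) (by have := sub_pos.2 hx; positivity)
    have hHG : speedSq f q₀ = fun x => 2 * x * G x := by
      funext x
      rw [speedSq, hG, mul_div_assoc]
    have hdH : ∀ x < q₀, deriv (speedSq f q₀) x = 2 * (G x + x * deriv G x) := by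
      intro x hx
      have h1 := ((hasDerivAt_id x).const_mul 2).mul
        (((hGc x hx).differentiableAt (by norm_num)).hasDerivAt)
      rw [hHG]
      refine HasDerivAt.deriv ?_
      convert! h1 using 1
      simp only [id]
      ring
    have hG0 : G 0 ≠ 0 := by
      intro h
      exact hH (by rw [hdH 0 haq, h]; simp)
    -- With r = R h and h = 2rG(r), this φ is (q₀ − r)/(2r(G + rG')) − q₀/(2rG): the terms of order
    -- 1/r cancel in the numerator.
    refine ⟨q₀, fun x => -((G x + q₀ * deriv G x) / (2 * G x * (G x + x * deriv G x))), ?_, ?_⟩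
    · have h1 : ContDiffAt ℝ 1 G 0 := (hGc 0 haq).of_le (by norm_num)
      have h2 : ContDiffAt ℝ 1 (deriv G) 0 := ContDiffAt.derivWithin (hGc 0 haq) (by norm_num)
      refine (ContDiffAt.div (by fun_prop) (by fun_prop) ?_).neg
      simpa using hG0
    · filter_upwards [Ioo_mem_nhdsGT hM] with h hh
      have e1 := hR.apply_eq h hh
      have e2 := hR.deriv_pos h hh
      have e3 := (hR.pos h hh).ne'
      rw [hdH _ (hR.lt h hh)] at e2 ⊢
      simp only [hHG] at e1
      have e4 : G (R h) ≠ 0 := by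
        intro h0
        rw [h0, mul_zero] at e1
        exact hh.1.ne e1
      have e5 : G (R h) + R h * deriv G (R h) ≠ 0 := by
        intro h0
        rw [h0, mul_zero] at e2
        exact lt_irrefl _ e2
      generalize deriv G (R h) = g' at e1 e2 e3 e4 e5 ⊢
      generalize G (R h) = g at e1 e2 e3 e4 e5 ⊢
      generalize R h = r at e1 e2 e3 e4 e5 ⊢
      rw [← e1]
      field_simp
      ring

theorem IsDarkSoliton.congr {f g : ℝ → ℝ} (hfg : EqOn g f (Ici 0)) {q₀ ω v : ℝ} {U : ℝ → ℂ}
    (h : IsDarkSoliton f q₀ ω v U) : IsDarkSoliton g q₀ ω v U := by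
  refine ⟨⟨h.1.1, fun x t => ?_⟩, h.2⟩
  rw [hfg (mem_Ici.2 (sq_nonneg _))]
  exact h.1.2 x t

/-! ### The family of solitons and the main theorem -/

section Family

variable {f : ℝ → ℝ} {q₀ c : ℝ} {U : ℝ → ℝ → ℂ}

theorem isLastCrossing_family (hf : ContDiff ℝ 2 f) (hc : 0 < c)
    (hprof : ∀ v ∈ Ioo 0 c, ∃ ρ', IsDensityProfile f q₀ (v ^ 2) (fun z => ‖U v z‖ ^ 2) ρ') :
    IsLastCrossing (speedSq f q₀) q₀ (c ^ 2) (fun h => ‖U (Real.sqrt h) 0‖ ^ 2) := by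
  have hp : ∀ h ∈ Ioo 0 (c ^ 2), ∃ ρ', IsDensityProfile f q₀ h
      (fun z => ‖U (Real.sqrt h) z‖ ^ 2) ρ' := by
    intro h hh
    have := hprof (Real.sqrt h) ⟨Real.sqrt_pos.2 hh.1, (Real.sqrt_lt' hc).2 hh.2⟩
    rwa [Real.sq_sqrt hh.1.le] at this
  refine ⟨fun x hx => contDiffAt_speedSq hf hx, fun h hh => ?_, fun h hh => ?_, fun h hh => ?_,
    fun h hh => ?_, fun h hh x hx => ?_⟩ <;> obtain ⟨ρ', hρ⟩ := hp h hh
  · exact hρ.pos 0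
  · exact hρ.lt 0
  · exact hρ.speedSq_zero
  · exact hρ.deriv_speedSq_pos hf
  · exact hρ.lt_speedSq hf hx

/-- U at v and at −v are not assumed related. Both minimal densities lie on the level v² of H, and H
exceeds that level beyond either of them, so they coincide. -/
theorem norm_sq_zero_eq (hf : ContDiff ℝ 2 f)
    (hprof : ∀ v ∈ Ioo (-c) 0 ∪ Ioo 0 c,
      ∃ ρ', IsDensityProfile f q₀ (v ^ 2) (fun z => ‖U v z‖ ^ 2) ρ')
    {v : ℝ} (hv : v ∈ Ioo (-c) 0 ∪ Ioo 0 c) : ‖U (Real.sqrt (v ^ 2)) 0‖ ^ 2 = ‖U v 0‖ ^ 2 := by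
  have habs : |v| ∈ Ioo (-c) 0 ∪ Ioo 0 c := by
    right
    rcases hv with hv | hv
    · rw [abs_of_neg hv.2]
      exact ⟨by linarith [hv.2], by linarith [hv.1]⟩
    · rwa [abs_of_pos hv.1]
  obtain ⟨ρ', h1⟩ := hprof v hv
  obtain ⟨σ', h2⟩ := hprof |v| habs
  rw [sq_abs] at h2
  rw [Real.sqrt_sq_eq_abs]
  rcases lt_trichotomy (‖U |v| 0‖ ^ 2) (‖U v 0‖ ^ 2) with h | h | h
  · exact absurd h1.speedSq_zero (h2.lt_speedSq hf ⟨h, h1.lt 0⟩).ne'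
  · exact h
  · exact absurd h2.speedSq_zero (h1.lt_speedSq hf ⟨h, h2.lt 0⟩).ne'

/-- The turning point of the limiting black soliton is non-degenerate. -/
theorem deriv_speedSq_limit_ne_zero (hf : ContDiff ℝ 2 f) (hc : 0 < c)
    (hprof : ∀ v ∈ Ioo 0 c, ∃ ρ', IsDensityProfile f q₀ (v ^ 2) (fun z => ‖U v z‖ ^ 2) ρ')
    {φ₀ : ℝ → ℝ} (hlim : ∀ x, Tendsto (fun v => ‖U v x‖ ^ 2) (𝓝[>] 0) (𝓝 (φ₀ x ^ 2)))
    (h0 : φ₀ 0 ^ 2 < q₀) (htop : Tendsto (fun x => φ₀ x ^ 2) atTop (𝓝 q₀)) :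
    deriv (speedSq f q₀) (φ₀ 0 ^ 2) ≠ 0 := by
  intro hder
  set a := φ₀ 0 ^ 2 with ha
  have hev : ∀ᶠ v in 𝓝[>] (0 : ℝ), v ∈ Ioo 0 c := Ioo_mem_nhdsGT hc
  have hHd := hasDerivAt_speedSq hf h0
  have hHa : speedSq f q₀ a = 0 := by
    have h1 := (hHd.continuousAt.tendsto).comp (hlim 0)
    have h2 : Tendsto (fun v : ℝ => v ^ 2) (𝓝[>] 0) (𝓝 0) := by
      have := (continuous_pow 2).tendsto (0 : ℝ)
      rw [zero_pow two_ne_zero] at this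
      exact this.mono_left nhdsWithin_le_nhds
    refine tendsto_nhds_unique h1 (h2.congr' ?_)
    filter_upwards [hev] with v hv
    obtain ⟨ρ', hρ⟩ := hprof v hv
    exact hρ.speedSq_zero.symm
  set Q : ℝ → ℝ := fun x => 8 * x * bgPotential f q₀ x with hQdef
  have hQ : ContDiff ℝ 2 Q := by
    have hF : ContDiff ℝ 2 (bgPotential f q₀) := (contDiff_bgPotential hf q₀).of_le (by norm_num)
    fun_prop
  have hQH : ∀ x < q₀, Q x = 4 * (q₀ - x) ^ 2 * speedSq f q₀ x := fun x hx => by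
    rw [mul_assoc, mul_speedSq f hx, hQdef]
    ring
  have hQa : Q a = 0 := by rw [hQH a h0, hHa, mul_zero]
  have hQ'a : deriv Q a = 0 := by
    have h1 := ((((hasDerivAt_id a).const_sub q₀).pow 2).const_mul 4).mul hHd
    have h2 : HasDerivAt Q _ a := h1.congr_of_eventuallyEq (by
      filter_upwards [Iio_mem_nhds h0] with x hx using hQH x hx)
    rw [h2.deriv, hder, hHa]
    simp
  obtain ⟨K, hK, hKQ⟩ := hQ.exists_le_mul_sq (b := 0) (q := q₀) ⟨sq_nonneg _, h0.le⟩ hQa hQ'a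
  have hR := isLastCrossing_family hf hc hprof
  -- The minimal density increases with the speed, so its limit at 0⁺ is a lower bound; the Gronwall
  -- estimate needs this sign.
  have hmono : ∀ v ∈ Ioo 0 c, a ≤ ‖U v 0‖ ^ 2 := by
    intro v hv
    refine le_of_tendsto (hlim 0) ?_
    filter_upwards [Ioo_mem_nhdsGT hv.1] with w hw
    have h1 := hR.strictMonoOn (a := w ^ 2) (b := v ^ 2)
      ⟨pow_pos hw.1 2, pow_lt_pow_left₀ (hw.2.trans hv.2) hw.1.le two_ne_zero⟩
      ⟨pow_pos hv.1 2, pow_lt_pow_left₀ hv.2 hv.1.le two_ne_zero⟩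
      (pow_lt_pow_left₀ hw.2 hw.1.le two_ne_zero)
    simp only [Real.sqrt_sq hw.1.le, Real.sqrt_sq hv.1.le] at h1
    exact h1.le
  -- At fixed z the Gronwall bound is a fixed exponential times a quantity tending to 0, so the
  -- limit density never rises above a, against its limit q₀ at infinity.
  have hle : ∀ z, 0 ≤ z → φ₀ z ^ 2 - a ≤ 0 := by
    intro z hz
    have h1 := ((hlim 0).sub_const a).mul_const (Real.exp (Real.sqrt K * z))
    rw [← ha, sub_self, zero_mul] at h1
    refine le_of_tendsto_of_tendsto ((hlim z).sub_const a) h1 ?_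
    filter_upwards [hev] with v hv
    obtain ⟨ρ', hρ⟩ := hprof v hv
    exact hρ.sub_le_exp hf (sq_nonneg v) hK hKQ (hmono v hv) hz
  have : q₀ ≤ a := by
    refine le_of_tendsto htop ?_
    filter_upwards [eventually_ge_atTop 0] with z hz
    linarith [hle z hz]
  exact this.not_gt h0

end Family

theorem IsBlackSoliton.sq_zero_lt {q₀ : ℝ} (hq₀ : 0 < q₀) {U : ℝ → ℝ → ℂ} {φ : ℝ → ℝ}
    (h : IsBlackSoliton q₀ U φ) : φ 0 ^ 2 < q₀ := by
  rcases h.2.2 with h | h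
  · exact (Real.lt_sqrt h.2.1).1 h.2.2.1
  · rw [h.2.1]
    simpa using hq₀

theorem IsBlackSoliton.tendsto_sq {q₀ : ℝ} (hq₀ : 0 < q₀) {U : ℝ → ℝ → ℂ} {φ : ℝ → ℝ}
    (h : IsBlackSoliton q₀ U φ) : Tendsto (fun x => φ x ^ 2) atTop (𝓝 q₀) := by
  have : Tendsto φ atTop (𝓝 (Real.sqrt q₀)) := by
    rcases h.2.2 with h | h
    · exact h.2.2.2.1.tendsto
    · exact h.2.2.1.tendsto
  simpa [Real.sq_sqrt hq₀.le] using this.pow 2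

theorem mainTheorem12 (f : ℝ → ℝ) (q₀ c : ℝ)
    (hf : ContDiffOn ℝ 2 f (Set.Ici 0))
    (hq₀ : 0 < q₀) (hf' : 0 < deriv f q₀)
    (hc : c = Real.sqrt (q₀ * deriv f q₀))
    (U : ℝ → ℝ → ℂ)
    (hU : ∀ v ∈ Set.Ioo (-c) 0 ∪ Set.Ioo 0 c, IsDarkSoliton f q₀ (f q₀) v (U v)) :
    (∀ v ∈ Set.Ioo (-c) 0 ∪ Set.Ioo 0 c, Integrable (momentumDensity q₀ (U v))) ∧
    ContDiffOn ℝ 1 (fun v => renormalizedMomentum q₀ (U v))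
      (Set.Ioo (-c) 0 ∪ Set.Ioo 0 c) ∧
    (∀ φ₀ : ℝ → ℝ, IsBlackSoliton q₀ U φ₀ →
      ∃ L : ℝ, Tendsto (deriv (fun v => renormalizedMomentum q₀ (U v))) (𝓝[>] 0) (𝓝 L)) := by
  have hc0 : 0 < c := hc ▸ Real.sqrt_pos.2 (mul_pos hq₀ hf')
  obtain ⟨g, hg, hgf⟩ := exists_contDiff_two_extension hf
  have hv0 : ∀ v ∈ Ioo (-c) 0 ∪ Ioo 0 c, v ≠ 0 := by
    rintro v (hv | hv)
    · exact hv.2.ne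
    · exact hv.1.ne'
  have hsol := fun v (hv : v ∈ Ioo (-c) 0 ∪ Ioo 0 c) => by
    have h1 := (hU v hv).congr hgf
    rw [← hgf (mem_Ici.2 hq₀.le)] at h1
    exact h1.isDensityProfile hg.continuous hq₀ (hv0 v hv)
  have hprof := fun v hv => (hsol v hv).1
  have hprof' : ∀ v ∈ Ioo 0 c, ∃ ρ', IsDensityProfile g q₀ (v ^ 2) (fun z => ‖U v z‖ ^ 2) ρ' :=
    fun v hv => hprof v (Or.inr hv)
  have hR := isLastCrossing_family hg hc0 hprof'
  set R : ℝ → ℝ := fun h => ‖U (Real.sqrt h) 0‖ ^ 2 with hRdef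
  set H := speedSq g q₀
  have hint : ∀ h ∈ Ioo 0 (c ^ 2),
      IntegrableOn (fun x => (q₀ - x) / (x * Real.sqrt (H x - h))) (Ioo (R h) q₀) := by
    intro h hh
    obtain ⟨ρ', hρ⟩ := hprof' (Real.sqrt h) ⟨Real.sqrt_pos.2 hh.1, (Real.sqrt_lt' hc0).2 hh.2⟩
    rw [Real.sq_sqrt hh.1.le] at hρ
    exact hρ.integrableOn_density hg
  have hP : ∀ v ∈ Ioo (-c) 0 ∪ Ioo 0 c,
      renormalizedMomentum q₀ (U v) = -(v * turningIntegral H R q₀ (v ^ 2)) := by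
    intro v hv
    obtain ⟨⟨ρ', hρ⟩, hd⟩ := hsol v hv
    rw [renormalizedMomentum]
    simp only [hd]
    rw [integral_complex_ofReal, Complex.ofReal_re, integral_const_mul, hρ.integral_eq hg, turningIntegral, hRdef]
    simp only [norm_sq_zero_eq hg hprof hv]
    ring
  have hsq : ∀ v ∈ Ioo (-c) 0 ∪ Ioo 0 c, v ^ 2 ∈ Ioo 0 (c ^ 2) := by
    intro v hv
    have := hv0 v hv
    refine ⟨by positivity, sq_lt_sq' ?_ ?_⟩ <;> rcases hv with hv | hv <;> linarith [hv.1, hv.2]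
  refine ⟨fun v hv => ?_, ?_, fun φ₀ hφ₀ => ?_⟩
  · obtain ⟨⟨ρ', hρ⟩, hd⟩ := hsol v hv
    rw [show momentumDensity q₀ (U v) = _ from funext hd]
    exact ((hρ.integrable hg).const_mul (-v)).ofReal
  · refine ContDiffOn.congr (fun v hv => ?_) hP
    -- The cut level only has to exceed v², so it may be chosen separately at each speed.
    obtain ⟨h₁, hv1, hv2⟩ := exists_between (hsq v hv).2
    obtain ⟨J', hJ'⟩ := hR.exists_hasContDerivOn hint ⟨(hsq v hv).1.trans hv1, hv2⟩
    have h1 : ContDiffAt ℝ 1 (turningIntegral H R q₀) (v ^ 2) :=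
      hJ'.contDiffOn.contDiffAt (Ioo_mem_nhds (hsq v hv).1 hv1)
    have h2 : ContDiffAt ℝ 1 (fun v => turningIntegral H R q₀ (v ^ 2)) v :=
      ContDiffAt.comp (f := fun v : ℝ => v ^ 2) v h1 (by fun_prop)
    exact ((contDiffAt_id.mul h2).neg).contDiffWithinAt
  · have hlim : ∀ x, Tendsto (fun v => ‖U v x‖ ^ 2) (𝓝[>] 0) (𝓝 (φ₀ x ^ 2)) := by
      intro x
      have := ((hφ₀.1 x).norm).pow 2
      simpa using this
    have h0 := hφ₀.sq_zero_lt hq₀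
    have hne := deriv_speedSq_limit_ne_zero hg hc0 hprof' hlim h0 (hφ₀.tendsto_sq hq₀)
    obtain ⟨l, φ, hφ, heq⟩ := exists_regular_part hg hR (pow_pos hc0 2) (sq_nonneg _) h0 hne
    have hRa : Tendsto R (𝓝[>] 0) (𝓝 (φ₀ 0 ^ 2)) := by
      refine (hlim 0).comp (f := Real.sqrt) (tendsto_nhdsWithin_iff.2 ⟨?_, ?_⟩)
      · have := Real.continuous_sqrt.tendsto 0
        rw [Real.sqrt_zero] at this
        exact this.mono_left nhdsWithin_le_nhds
      · filter_upwards [self_mem_nhdsWithin] with h hh using Real.sqrt_pos.2 hh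
    obtain ⟨L, hL⟩ := hR.exists_tendsto_deriv (pow_pos hc0 2) hint hRa h0 hne hφ heq
    refine ⟨-L, hL.neg.congr' ?_⟩
    filter_upwards [Ioo_mem_nhdsGT hc0] with v hv
    have h1 : (fun v => renormalizedMomentum q₀ (U v))
        =ᶠ[𝓝 v] fun v => -(v * turningIntegral H R q₀ (v ^ 2)) := by
      filter_upwards [Ioo_mem_nhds hv.1 hv.2] with w hw using hP w (Or.inr hw)
    rw [h1.deriv_eq, deriv.fun_neg]
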